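/- Let $R$ be a unital ring (not necessarily commutative); all modules are left modules. A Sylvester map rank function for $R$ is a function $\mathrm{rk}$ assigning to every homomorphism between finitely generated projective $R$-modules a number in $\mathbb{R}_{\ge 0}$ such that (1) $\mathrm{rk}(0)=0$ for zero maps and $\mathrm{rk}(\mathrm{id}_R)=1$; (2) the composite of any two composable maps $\alpha,\beta$ has rank at most $\min(\mathrm{rk}(\alpha),\mathrm{rk}(\beta))$; (3) $\mathrm{rk}(\alpha\oplus\beta)=\mathrm{rk}(\alpha)+\mathrm{rk}(\beta)$; (4) for $\alpha:P_1\to Q_1$, $\beta:P_2\to Q_2$ and $\gamma:P_1\to Q_2$, the map $P_1\oplus P_2\to Q_1\oplus Q_2$, $(x,y)\mapsto(\alpha(x),\gamma(x)+\beta(y))$, has rank at least $\mathrm{rk}(\alpha)+\mathrm{rk}(\beta)$. Let $\mathbb{P}(R)$ be the set of these functions. For a unital ring homomorphism $\pi:R\to S$ let $\pi^*:\mathbb{P}(S)\to\mathbb{P}(R)$ be given by $\pi^*(\mathrm{rk}_S)(\alpha)=\mathrm{rk}_S(\mathrm{id}_S\otimes_R\alpha)$. Let $\Sigma$ be a set of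 homomorphisms between finitely generated projective $R$-modules, and let $\pi:R\to R_\Sigma$ be the universal localization of $R$ at $\Sigma$, i.e. the universal unital ring homomorphism from $R$ such that $\mathrm{id}_{R_\Sigma}\otimes_R\alpha$ is an isomorphism for every $\alpha\in\Sigma$. **Theorem 8.4 (Schofield).** Suppose $\mathrm{rk}\in\mathbb{P}(R)$ satisfies $\mathrm{rk}(\alpha)=\mathrm{rk}(\mathrm{id}_{\mathrm{dom}(\alpha)})=\mathrm{rk}(\mathrm{id}_{\mathrm{cod}(\alpha)})$ for every $\alpha\in\Sigma$. Then $R_\Sigma$ is nonzero and $\mathrm{rk}\in\pi^*(\mathbb{P}(R_\Sigma))$. -/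

import Mathlib

open scoped NNReal TensorProduct

universe u v w

/-- A Sylvester map rank function for the ring `R`: an `ℝ≥0`-valued function on the class of all
homomorphisms between finitely generated projective left `R`-modules.  In `rk_triangular` the map
`(x, y) ↦ (f x, h x + g y)` is the triangular block map with diagonal `f, g` and corner `h`. -/
structure SylvesterMapRank (R : Type u) [Ring R] where
  rk : ∀ {P Q : Type u} [AddCommGroup P] [Module R P] [Module.Finite R P] [Module.Projective R P]
    [AddCommGroup Q] [Module R Q] [Module.Finite R Q] [Module.Projective R Q],
    (P →ₗ[R] Q) → ℝ≥0
  rk_zero : ∀ {P Q : Type u} [AddCommGroup P] [Module R P] [Module.Finite R P]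
    [Module.Projective R P] [AddCommGroup Q] [Module R Q] [Module.Finite R Q]
    [Module.Projective R Q], rk (0 : P →ₗ[R] Q) = 0
  rk_id : rk (LinearMap.id : R →ₗ[R] R) = 1
  rk_comp_le : ∀ {P Q N : Type u} [AddCommGroup P] [Module R P] [Module.Finite R P]
    [Module.Projective R P] [AddCommGroup Q] [Module R Q] [Module.Finite R Q]
    [Module.Projective R Q] [AddCommGroup N] [Module R N] [Module.Finite R N]
    [Module.Projective R N] (f : P →ₗ[R] Q) (g : Q →ₗ[R] N),
    rk (g ∘ₗ f) ≤ min (rk f) (rk g)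
  rk_diag : ∀ {P₁ Q₁ P₂ Q₂ : Type u} [AddCommGroup P₁] [Module R P₁] [Module.Finite R P₁]
    [Module.Projective R P₁] [AddCommGroup Q₁] [Module R Q₁] [Module.Finite R Q₁]
    [Module.Projective R Q₁] [AddCommGroup P₂] [Module R P₂] [Module.Finite R P₂]
    [Module.Projective R P₂] [AddCommGroup Q₂] [Module R Q₂] [Module.Finite R Q₂]
    [Module.Projective R Q₂] (f : P₁ →ₗ[R] Q₁) (g : P₂ →ₗ[R] Q₂),
    rk (f.prodMap g) = rk f + rk g
  rk_triangular : ∀ {P₁ Q₁ P₂ Q₂ : Type u} [AddCommGroup P₁] [Module R P₁] [Module.Finite R P₁]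
    [Module.Projective R P₁] [AddCommGroup Q₁] [Module R Q₁] [Module.Finite R Q₁]
    [Module.Projective R Q₁] [AddCommGroup P₂] [Module R P₂] [Module.Finite R P₂]
    [Module.Projective R P₂] [AddCommGroup Q₂] [Module R Q₂] [Module.Finite R Q₂]
    [Module.Projective R Q₂] (f : P₁ →ₗ[R] Q₁) (g : P₂ →ₗ[R] Q₂) (h : P₁ →ₗ[R] Q₂),
    rk f + rk g ≤
      rk ((f ∘ₗ LinearMap.fst R P₁ P₂).prod (h ∘ₗ LinearMap.fst R P₁ P₂ + g ∘ₗ LinearMap.snd R P₁ P₂))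

/-- The `S`-submodule of `S ⊗[ℤ] M` generated by the elements `s π(r) ⊗ m - s ⊗ r m`. -/
def baseChangeRel {R : Type*} {S : Type*} [Ring R] [Ring S] (π : R →+* S)
    (M : Type*) [AddCommGroup M] [Module R M] : Submodule S (S ⊗[ℤ] M) :=
  Submodule.span S {x | ∃ (s : S) (r : R) (m : M), x = (s * π r) ⊗ₜ[ℤ] m - s ⊗ₜ[ℤ] (r • m)}

/-- The left `S`-module `S ⊗_R M` for a homomorphism `π : R → S` of (not necessarily commutative)
rings and a left `R`-module `M`. -/
abbrev BaseChange {R : Type*} {S : Type*} [Ring R] [Ring S] (π : R →+* S)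
    (M : Type*) [AddCommGroup M] [Module R M] :=
  (S ⊗[ℤ] M) ⧸ baseChangeRel π M

namespace BaseChange

section basics

variable {R : Type*} {S : Type*} [Ring R] [Ring S] (π : R →+* S)
variable {M : Type*} [AddCommGroup M] [Module R M]
variable {N : Type*} [AddCommGroup N] [Module R N]
variable {L : Type*} [AddCommGroup L] [Module R L]
variable {K : Type*} [AddCommGroup K] [Module S K]

/-- The canonical map `M → S ⊗_R M`, `m ↦ 1 ⊗ m`. -/
def unit (M : Type*) [AddCommGroup M] [Module R M] : M →ₛₗ[π] BaseChange π M where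
  toFun m := (baseChangeRel π M).mkQ (1 ⊗ₜ[ℤ] m)
  map_add' x y := by rw [TensorProduct.tmul_add, map_add]
  map_smul' r m := by
    rw [← map_smul, eq_comm, ← sub_eq_zero, ← map_sub, Submodule.mkQ_apply,
      Submodule.Quotient.mk_eq_zero]
    exact Submodule.subset_span ⟨1, r, m, by rw [TensorProduct.smul_tmul', smul_eq_mul]; simp⟩

/-- The `S`-linear map `S ⊗_R M → K`, `s ⊗ m ↦ s f(m)`, induced by a map `f : M → K` that is linear
along `π`. -/
def lift {π : R →+* S} (f : M →ₛₗ[π] K) : BaseChange π M →ₗ[S] K :=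
  (baseChangeRel π M).liftQ
    (TensorProduct.AlgebraTensorModule.lift
      (LinearMap.toSpanSingleton S (M →ₗ[ℤ] K) f.toAddMonoidHom.toIntLinearMap)) (by
    rw [baseChangeRel, Submodule.span_le]
    rintro _ ⟨s, r, m, rfl⟩
    simp [mul_smul])

@[simp] theorem lift_unit (f : M →ₛₗ[π] K) (m : M) : lift f (unit π M m) = f m := by
  simp [lift, unit]

theorem span_unit : Submodule.span S (Set.range (unit π M)) = ⊤ := by
  rw [eq_top_iff]
  rintro x -
  obtain ⟨y, rfl⟩ := (baseChangeRel π M).mkQ_surjective x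
  induction y using TensorProduct.induction_on with
  | zero => simp
  | add a b ha hb => rw [map_add]; exact add_mem ha hb
  | tmul s m =>
    have h : (baseChangeRel π M).mkQ (s ⊗ₜ[ℤ] m) = s • unit π M m := by
      change _ = s • (baseChangeRel π M).mkQ (1 ⊗ₜ[ℤ] m)
      rw [← map_smul, TensorProduct.smul_tmul', smul_eq_mul, mul_one]
    rw [h]
    exact Submodule.smul_mem _ _ (Submodule.subset_span ⟨m, rfl⟩)

theorem hom_ext {f g : BaseChange π M →ₗ[S] K} (h : ∀ m, f (unit π M m) = g (unit π M m)) :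
    f = g := by
  apply LinearMap.ext_on (span_unit π (M := M))
  rintro _ ⟨m, rfl⟩
  exact h m

/-- The map `id_S ⊗_R f : S ⊗_R M → S ⊗_R N`. -/
def map (f : M →ₗ[R] N) : BaseChange π M →ₗ[S] BaseChange π N :=
  lift ((unit π N).comp f)

@[simp] theorem map_unit (f : M →ₗ[R] N) (m : M) :
    map π f (unit π M m) = unit π N (f m) := by
  simp [map]

theorem map_comp (f : M →ₗ[R] N) (g : N →ₗ[R] L) : map π (g ∘ₗ f) = map π g ∘ₗ map π f :=
  hom_ext π (by simp)

theorem map_id : map π (LinearMap.id : M →ₗ[R] M) = LinearMap.id :=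
  hom_ext π (by simp)

theorem map_zero : map π (0 : M →ₗ[R] N) = 0 :=
  hom_ext π (by simp)

instance finite [Module.Finite R M] : Module.Finite S (BaseChange π M) := by
  obtain ⟨s, hs⟩ := (Module.Finite.fg_top : (⊤ : Submodule R M).FG)
  classical
  refine ⟨⟨s.image (unit π M), ?_⟩⟩
  rw [eq_top_iff, ← span_unit π (M := M), Submodule.span_le]
  rintro _ ⟨m, rfl⟩
  have hm : m ∈ Submodule.span R (s : Set M) := by rw [hs]; trivial
  induction hm using Submodule.span_induction with
  | mem x hx =>
    exact Submodule.subset_span (by simpa using ⟨x, hx, rfl⟩)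
  | zero => rw [_root_.map_zero]; exact Submodule.zero_mem _
  | add x y _ _ hx hy => rw [map_add]; exact Submodule.add_mem _ hx hy
  | smul r x _ hx => rw [map_smulₛₗ]; exact Submodule.smul_mem _ _ hx

instance projective [Module.Projective R M] : Module.Projective S (BaseChange π M) := by
  obtain ⟨s, hs⟩ := (Module.projective_def'.1 ‹Module.Projective R M›)
  let t : M →ₛₗ[π] (M →₀ S) :=
    { toFun := fun m => (s m).mapRange π (_root_.map_zero π)
      map_add' := fun x y => by
        ext a
        simp
      map_smul' := fun r x => by
        ext a
        simp }
  refine Module.Projective.of_split (lift t) (Finsupp.linearCombination S (unit π M)) ?_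
  refine hom_ext π fun m => ?_
  have key : ∀ z : M →₀ R, Finsupp.linearCombination S (unit π M)
      (z.mapRange π (_root_.map_zero π)) = unit π M (Finsupp.linearCombination R id z) := by
    intro z
    induction z using Finsupp.induction_linear with
    | zero => simp
    | add a b ha hb => rw [Finsupp.mapRange_add (by simp), map_add, ha, hb, map_add, map_add]
    | single a r => simp [map_smulₛₗ]
  have h2 := LinearMap.congr_fun hs m
  simp only [LinearMap.comp_apply, LinearMap.id_apply] at h2 ⊢
  rw [lift_unit]
  exact (key (s m)).trans (congrArg _ h2)

/-- The isomorphism `S ⊗_R R ≅ S`. -/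
def ringEquiv : BaseChange π R ≃ₗ[S] S :=
  LinearEquiv.ofLinearMap (lift π.toSemilinearMap) (LinearMap.toSpanSingleton S _ (unit π R 1))
    (by ext; simp)
    (hom_ext π fun r => by
      have : unit π R r = π r • unit π R 1 := by rw [← map_smulₛₗ]; simp
      simp [this])

/-- The isomorphism `S ⊗_R (M ⊕ N) ≅ (S ⊗_R M) ⊕ (S ⊗_R N)`. -/
def prodEquiv (M N : Type*) [AddCommGroup M] [Module R M] [AddCommGroup N] [Module R N] :
    BaseChange π (M × N) ≃ₗ[S] BaseChange π M × BaseChange π N :=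
  LinearEquiv.ofLinearMap ((map π (LinearMap.fst R M N)).prod (map π (LinearMap.snd R M N)))
    ((map π (LinearMap.inl R M N)).coprod (map π (LinearMap.inr R M N)))
    (by
      apply LinearMap.prod_ext <;> refine hom_ext π fun m => ?_ <;> simp)
    (hom_ext π fun m => by simp [← map_add])

@[simp] theorem prodEquiv_unit (x : M × N) :
    prodEquiv π M N (unit π (M × N) x) = (unit π M x.1, unit π N x.2) := by
  simp [prodEquiv]

end basics

end BaseChange

namespace SylvesterMapRank

theorem rk_congr {R : Type u} [Ring R] (ρ : SylvesterMapRank R) {P Q P' Q' : Type u}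
    [AddCommGroup P] [Module R P] [Module.Finite R P] [Module.Projective R P]
    [AddCommGroup Q] [Module R Q] [Module.Finite R Q] [Module.Projective R Q]
    [AddCommGroup P'] [Module R P'] [Module.Finite R P'] [Module.Projective R P']
    [AddCommGroup Q'] [Module R Q'] [Module.Finite R Q'] [Module.Projective R Q']
    (e : P ≃ₗ[R] P') (e' : Q ≃ₗ[R] Q') (f : P →ₗ[R] Q) (f' : P' →ₗ[R] Q')
    (h : e'.toLinearMap ∘ₗ f = f' ∘ₗ e.toLinearMap) : ρ.rk f = ρ.rk f' := by
  have key : ∀ {P Q P' Q' : Type u}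
      [AddCommGroup P] [Module R P] [Module.Finite R P] [Module.Projective R P]
      [AddCommGroup Q] [Module R Q] [Module.Finite R Q] [Module.Projective R Q]
      [AddCommGroup P'] [Module R P'] [Module.Finite R P'] [Module.Projective R P']
      [AddCommGroup Q'] [Module R Q'] [Module.Finite R Q'] [Module.Projective R Q']
      (e : P ≃ₗ[R] P') (e' : Q ≃ₗ[R] Q') (f : P →ₗ[R] Q) (f' : P' →ₗ[R] Q')
      (_ : e'.toLinearMap ∘ₗ f = f' ∘ₗ e.toLinearMap), ρ.rk f ≤ ρ.rk f' := by
    intro P Q P' Q' _ _ _ _ _ _ _ _ _ _ _ _ _ _ _ _ e e' f f' h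
    have hf : f = e'.symm.toLinearMap ∘ₗ (f' ∘ₗ e.toLinearMap) := by
      rw [← h]; ext; simp
    rw [hf]
    exact ((ρ.rk_comp_le _ _).trans (min_le_left _ _)).trans
      ((ρ.rk_comp_le _ _).trans (min_le_right _ _))
  refine le_antisymm (key e e' f f' h) (key e.symm e'.symm f' f ?_)
  ext x
  have := LinearMap.congr_fun h (e.symm x)
  simp at this
  simp [← this]

/-- The pull-back `π^*` of Sylvester rank functions along a ring homomorphism `π : R → S`:
`(π^* ρ)(f) = ρ(id_S ⊗_R f)`. -/
def pullback {R : Type u} {S : Type (max u v)} [Ring R] [Ring S] (π : R →+* S)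
    (ρ : SylvesterMapRank S) : SylvesterMapRank R where
  rk f := ρ.rk (BaseChange.map π f)
  rk_zero := by
    intros
    rw [BaseChange.map_zero, ρ.rk_zero]
  rk_id := by
    rw [← ρ.rk_id]
    exact ρ.rk_congr (BaseChange.ringEquiv π) (BaseChange.ringEquiv π) _ _
      (by rw [BaseChange.map_id]; rfl)
  rk_comp_le f g := by
    rw [BaseChange.map_comp]
    exact ρ.rk_comp_le _ _
  rk_diag f g := by
    rw [← ρ.rk_diag]
    exact ρ.rk_congr (BaseChange.prodEquiv π _ _) (BaseChange.prodEquiv π _ _) _ _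
      (BaseChange.hom_ext π fun x => by simp)
  rk_triangular f g h := by
    refine (ρ.rk_triangular (BaseChange.map π f) (BaseChange.map π g)
      (BaseChange.map π h)).trans (le_of_eq ?_)
    refine (ρ.rk_congr (BaseChange.prodEquiv π _ _) (BaseChange.prodEquiv π _ _) _ _
      (BaseChange.hom_ext π fun x => ?_)).symm
    simp

end SylvesterMapRank

/-- A ring homomorphism `π : R → S` inverts the family `α` of homomorphisms of left `R`-modules if
every `id_S ⊗_R α i` is an isomorphism. -/
def Inverts {R : Type*} [Ring R] {ι : Type*} {P Q : ι → Type*}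
    [∀ i, AddCommGroup (P i)] [∀ i, Module R (P i)]
    [∀ i, AddCommGroup (Q i)] [∀ i, Module R (Q i)] (α : ∀ i, P i →ₗ[R] Q i)
    {S : Type*} [Ring S] (π : R →+* S) : Prop :=
  ∀ i, Function.Bijective (BaseChange.map π (α i))

section localization

variable {R : Type u} [Ring R] {ι : Type w} {P Q : ι → Type u}
variable [∀ i, AddCommGroup (P i)] [∀ i, Module R (P i)]
variable [∀ i, AddCommGroup (Q i)] [∀ i, Module R (Q i)]

/-- Generators of the universal localization: the elements of `R`, and for each `i`, each `q : Q i`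
and each linear form `f` on `P i` a symbol standing for `f (α i⁻¹ q)`. -/
inductive LocGen (R : Type u) [Ring R] {ι : Type w} (P Q : ι → Type u)
    [∀ i, AddCommGroup (P i)] [∀ i, Module R (P i)] : Type (max u w)
  | coe (r : R) : LocGen R P Q
  | inv (i : ι) (q : Q i) (f : P i →ₗ[R] R) : LocGen R P Q

/-- The element `r` of `R` in the free ring on the generators. -/
abbrev LocGen.c (P Q : ι → Type u) [∀ i, AddCommGroup (P i)] [∀ i, Module R (P i)] (r : R) :
    FreeAlgebra ℤ (LocGen R P Q) :=
  FreeAlgebra.ι ℤ (LocGen.coe r)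

/-- The symbol for `f (α i⁻¹ q)` in the free ring on the generators. -/
abbrev LocGen.b {P Q : ι → Type u} [∀ i, AddCommGroup (P i)] [∀ i, Module R (P i)]
    (i : ι) (q : Q i) (f : P i →ₗ[R] R) : FreeAlgebra ℤ (LocGen R P Q) :=
  FreeAlgebra.ι ℤ (LocGen.inv i q f)

/-- Defining relations of the universal localization: those of `R`; bilinearity of the symbol for
`f (α i⁻¹ q)` in `q` and `f` (here `x ↦ f x • r` is the form `f` multiplied by `r` on the right);
and the two relations expressing that `α i⁻¹` is a left and a right inverse of `α i`. -/
inductive LocRel (α : ∀ i, P i →ₗ[R] Q i) :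
    FreeAlgebra ℤ (LocGen R P Q) → FreeAlgebra ℤ (LocGen R P Q) → Prop
  | coe_one : LocRel α (LocGen.c P Q 1) 1
  | coe_add (r s : R) : LocRel α (LocGen.c P Q (r + s)) (LocGen.c P Q r + LocGen.c P Q s)
  | coe_mul (r s : R) : LocRel α (LocGen.c P Q (r * s)) (LocGen.c P Q r * LocGen.c P Q s)
  | add_left (i : ι) (q q' : Q i) (f : P i →ₗ[R] R) :
      LocRel α (LocGen.b i (q + q') f) (LocGen.b i q f + LocGen.b i q' f)
  | add_right (i : ι) (q : Q i) (f f' : P i →ₗ[R] R) :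
      LocRel α (LocGen.b i q (f + f')) (LocGen.b i q f + LocGen.b i q f')
  | smul_left (i : ι) (r : R) (q : Q i) (f : P i →ₗ[R] R) :
      LocRel α (LocGen.b i (r • q) f) (LocGen.c P Q r * LocGen.b i q f)
  | smul_right (i : ι) (r : R) (q : Q i) (f : P i →ₗ[R] R) :
      LocRel α (LocGen.b i q (LinearMap.toSpanSingleton R R r ∘ₗ f))
        (LocGen.b i q f * LocGen.c P Q r)
  | inv_apply (i : ι) (p : P i) (f : P i →ₗ[R] R) :
      LocRel α (LocGen.b i (α i p) f) (LocGen.c P Q (f p))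
  | apply_inv (i : ι) (q : Q i) (g : Q i →ₗ[R] R) :
      LocRel α (LocGen.b i q (g ∘ₗ α i)) (LocGen.c P Q (g q))

/-- The universal localization of `R` inverting a family `α` of homomorphisms between finitely
generated projective left `R`-modules. -/
abbrev UniversalLocalization (α : ∀ i, P i →ₗ[R] Q i) : Type (max u w) :=
  RingQuot (LocRel α)

namespace UniversalLocalization

variable (α : ∀ i, P i →ₗ[R] Q i)

/-- The image in the universal localization of the symbol for `f (α i⁻¹ q)`. -/
def b (i : ι) (q : Q i) (f : P i →ₗ[R] R) : UniversalLocalization α :=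
  RingQuot.mkRingHom (LocRel α) (LocGen.b i q f)

/-- The canonical ring homomorphism from `R` to the universal localization. -/
def of : R →+* UniversalLocalization α where
  toFun r := RingQuot.mkRingHom (LocRel α) (LocGen.c P Q r)
  map_one' := by rw [RingQuot.mkRingHom_rel LocRel.coe_one, map_one]
  map_mul' r s := by rw [RingQuot.mkRingHom_rel (LocRel.coe_mul r s), map_mul]
  map_add' r s := by rw [RingQuot.mkRingHom_rel (LocRel.coe_add r s), map_add]
  map_zero' := by
    have h := RingQuot.mkRingHom_rel (LocRel.coe_add (α := α) 0 0)
    rw [add_zero, map_add] at h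
    exact left_eq_add.mp h

variable {α}

theorem b_add_left (i : ι) (q q' : Q i) (f : P i →ₗ[R] R) :
    b α i (q + q') f = b α i q f + b α i q' f := by
  simpa [b] using RingQuot.mkRingHom_rel (LocRel.add_left (α := α) i q q' f)

theorem b_add_right (i : ι) (q : Q i) (f f' : P i →ₗ[R] R) :
    b α i q (f + f') = b α i q f + b α i q f' := by
  simpa [b] using RingQuot.mkRingHom_rel (LocRel.add_right (α := α) i q f f')

theorem b_smul_left (i : ι) (r : R) (q : Q i) (f : P i →ₗ[R] R) :
    b α i (r • q) f = of α r * b α i q f := by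
  simpa [b, of] using RingQuot.mkRingHom_rel (LocRel.smul_left (α := α) i r q f)

theorem b_smul_right (i : ι) (r : R) (q : Q i) (f : P i →ₗ[R] R) :
    b α i q (LinearMap.toSpanSingleton R R r ∘ₗ f) = b α i q f * of α r := by
  simpa [b, of] using RingQuot.mkRingHom_rel (LocRel.smul_right (α := α) i r q f)

theorem b_inv_apply (i : ι) (p : P i) (f : P i →ₗ[R] R) :
    b α i (α i p) f = of α (f p) := by
  simpa [b, of] using RingQuot.mkRingHom_rel (LocRel.inv_apply (α := α) i p f)

theorem b_apply_inv (i : ι) (q : Q i) (g : Q i →ₗ[R] R) :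
    b α i q (g ∘ₗ α i) = of α (g q) := by
  simpa [b, of] using RingQuot.mkRingHom_rel (LocRel.apply_inv (α := α) i q g)

theorem b_sum_right (i : ι) (q : Q i) {κ : Type*} (s : Finset κ) (f : κ → (P i →ₗ[R] R)) :
    b α i q (∑ k ∈ s, f k) = ∑ k ∈ s, b α i q (f k) :=
  map_sum (AddMonoidHom.mk' (b α i q) (b_add_right i q)) f s

/-- A finitely generated projective module has a finite dual basis. -/
theorem exists_dual_basis (M : Type u) [AddCommGroup M] [Module R M] [Module.Finite R M]
    [Module.Projective R M] : ∃ (n : ℕ) (p : Fin n → M) (f : Fin n → (M →ₗ[R] R)),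
      ∀ x, x = ∑ j, f j x • p j := by
  obtain ⟨n, s, t, -, -, h⟩ := Module.Finite.exists_comp_eq_id_of_projective R M
  refine ⟨n, fun j => s (Pi.single j 1), fun j => LinearMap.proj j ∘ₗ t, fun x => ?_⟩
  have hx := LinearMap.congr_fun h x
  simp only [LinearMap.comp_apply, LinearMap.id_apply] at hx
  conv_lhs => rw [← hx, pi_eq_sum_univ' (t x)]
  simp [map_sum]

/-- The universal localization inverts the given family. -/
theorem inverts_of [∀ i, Module.Finite R (P i)] [∀ i, Module.Projective R (P i)]
    [∀ i, Module.Finite R (Q i)] [∀ i, Module.Projective R (Q i)] : Inverts α (of α) := by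
  intro i
  obtain ⟨n, p, f, hp⟩ := exists_dual_basis (R := R) (P i)
  obtain ⟨m, q, g, hq⟩ := exists_dual_basis (R := R) (Q i)
  let t : Q i →ₛₗ[of α] BaseChange (of α) (P i) :=
    { toFun := fun y => ∑ j, b α i y (f j) • BaseChange.unit (of α) (P i) (p j)
      map_add' := fun y y' => by simp [b_add_left, add_smul, Finset.sum_add_distrib]
      map_smul' := fun r y => by simp [b_smul_left, mul_smul, Finset.smul_sum] }
  have h1 : BaseChange.lift t ∘ₗ BaseChange.map (of α) (α i) = LinearMap.id := by
    refine BaseChange.hom_ext _ fun x => ?_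
    simp only [LinearMap.comp_apply, BaseChange.map_unit, BaseChange.lift_unit, LinearMap.id_apply]
    change ∑ j, b α i (α i x) (f j) • BaseChange.unit (of α) (P i) (p j) = _
    conv_rhs => rw [hp x]
    simp [b_inv_apply, map_sum, map_smulₛₗ]
  have h2 : BaseChange.map (of α) (α i) ∘ₗ BaseChange.lift t = LinearMap.id := by
    refine BaseChange.hom_ext _ fun y => ?_
    simp only [LinearMap.comp_apply, BaseChange.lift_unit, LinearMap.id_apply]
    change BaseChange.map (of α) (α i)
      (∑ j, b α i y (f j) • BaseChange.unit (of α) (P i) (p j)) = _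
    have hg : ∀ k, g k ∘ₗ α i =
        ∑ j, LinearMap.toSpanSingleton R R (g k (α i (p j))) ∘ₗ f j := by
      intro k
      ext x
      conv_lhs => rw [hp x]
      simp [map_sum]
    have e : ∀ j, BaseChange.unit (of α) (Q i) (α i (p j)) =
        ∑ k, of α (g k (α i (p j))) • BaseChange.unit (of α) (Q i) (q k) := by
      intro j
      conv_lhs => rw [hq (α i (p j))]
      simp [map_sum, map_smulₛₗ]
    simp only [map_sum, map_smul, BaseChange.map_unit]
    simp_rw [e, Finset.smul_sum, smul_smul]
    rw [Finset.sum_comm]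
    simp_rw [← Finset.sum_smul, ← b_smul_right, ← b_sum_right, ← hg, b_apply_inv]
    conv_rhs => rw [hq y]
    simp [map_sum, map_smulₛₗ]
  exact ⟨Function.LeftInverse.injective (LinearMap.congr_fun h1),
    Function.RightInverse.surjective (LinearMap.congr_fun h2)⟩

/-- The universal property: every ring homomorphism from `R` inverting the family factors uniquely
through the universal localization. -/
theorem existsUnique_lift [∀ i, Module.Finite R (P i)] [∀ i, Module.Projective R (P i)]
    [∀ i, Module.Finite R (Q i)] [∀ i, Module.Projective R (Q i)]
    {T : Type v} [Ring T] (φ : R →+* T) (hφ : Inverts α φ) :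
    ∃! ψ : UniversalLocalization α →+* T, ψ.comp (of α) = φ := by
  let e : ∀ i, BaseChange φ (P i) ≃ₗ[T] BaseChange φ (Q i) := fun i =>
    LinearEquiv.ofBijective (BaseChange.map φ (α i)) (hφ i)
  let ev : ∀ i, (P i →ₗ[R] R) → (BaseChange φ (P i) →ₗ[T] T) := fun i f =>
    BaseChange.lift (φ.toSemilinearMap.comp f)
  have ev_unit : ∀ i f p, ev i f (BaseChange.unit φ (P i) p) = φ (f p) := by
    intro i f p
    simp [ev]
  have e_symm : ∀ i p, (e i).symm (BaseChange.unit φ (Q i) (α i p)) =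
      BaseChange.unit φ (P i) p := by
    intro i p
    rw [LinearEquiv.symm_apply_eq]
    simp [e]
  let β : LocGen R P Q → T := fun x => match x with
    | .coe r => φ r
    | .inv i q f => ev i f ((e i).symm (BaseChange.unit φ (Q i) q))
  have hβ : ∀ ⦃x y⦄, LocRel α x y →
      (FreeAlgebra.lift ℤ β : FreeAlgebra ℤ (LocGen R P Q) →+* T) x =
      (FreeAlgebra.lift ℤ β : FreeAlgebra ℤ (LocGen R P Q) →+* T) y := by
    intro x y h
    induction h with
    | coe_one => simp [β]
    | coe_add r s => simp [β]
    | coe_mul r s => simp [β]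
    | add_left i q q' f => simp [β]
    | add_right i q f f' =>
      have : ev i (f + f') = ev i f + ev i f' :=
        BaseChange.hom_ext φ fun m => by simp [ev_unit]
      simp [β, this]
    | smul_left i r q f => simp [β, map_smulₛₗ]
    | smul_right i r q f =>
      have : ev i (LinearMap.toSpanSingleton R R r ∘ₗ f) =
          LinearMap.toSpanSingleton T T (φ r) ∘ₗ ev i f :=
        BaseChange.hom_ext φ fun m => by simp [ev_unit]
      simp [β, this]
    | inv_apply i p f => simp [β, e_symm, ev_unit]
    | apply_inv i q g =>
      have : ev i (g ∘ₗ α i) = BaseChange.lift (φ.toSemilinearMap.comp g) ∘ₗ (e i).toLinearMap :=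
        BaseChange.hom_ext φ fun m => by simp [ev_unit, e]
      simp [β, this]
  refine ⟨RingQuot.lift ⟨_, hβ⟩, ?_, ?_⟩
  · ext r
    simp [of, β]
  · intro ψ hψ
    have hof : ∀ r, ψ (of α r) = φ r := fun r => RingHom.congr_fun hψ r
    have hsuff : ∀ z : LocGen R P Q,
        ψ (RingQuot.mkRingHom (LocRel α) (FreeAlgebra.ι ℤ z)) = β z := by
      rintro (r | ⟨i, q, f⟩)
      · exact hof r
      · change ψ (b α i q f) = ev i f ((e i).symm (BaseChange.unit φ (Q i) q))
        obtain ⟨n, p, f', hp⟩ := exists_dual_basis (R := R) (P i)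
        obtain ⟨m, q', g, hq⟩ := exists_dual_basis (R := R) (Q i)
        have hi : (e i).symm (BaseChange.unit φ (Q i) q) =
            ∑ j, ψ (b α i q (f' j)) • BaseChange.unit φ (P i) (p j) := by
          rw [LinearEquiv.symm_apply_eq]
          have hg : ∀ k, g k ∘ₗ α i =
              ∑ j, LinearMap.toSpanSingleton R R (g k (α i (p j))) ∘ₗ f' j := by
            intro k
            ext x
            conv_lhs => rw [hp x]
            simp [map_sum]
          have e' : ∀ j, BaseChange.unit φ (Q i) (α i (p j)) =
              ∑ k, φ (g k (α i (p j))) • BaseChange.unit φ (Q i) (q' k) := by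
            intro j
            conv_lhs => rw [hq (α i (p j))]
            simp [map_sum, map_smulₛₗ]
          simp only [map_sum, map_smul, e, LinearEquiv.ofBijective_apply, BaseChange.map_unit]
          simp_rw [e', Finset.smul_sum, smul_smul]
          rw [Finset.sum_comm]
          simp_rw [← Finset.sum_smul, ← hof, ← map_mul, ← b_smul_right, ← map_sum,
            ← b_sum_right, ← hg, b_apply_inv, hof]
          conv_lhs => rw [hq q]
          simp [map_sum, map_smulₛₗ]
        have hf : f = ∑ j, LinearMap.toSpanSingleton R R (f (p j)) ∘ₗ f' j := by
          ext x
          conv_lhs => rw [hp x]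
          simp [map_sum]
        rw [hi]
        conv_lhs => rw [hf]
        simp [b_sum_right, b_smul_right, map_sum, hof, ev_unit]
    have := FreeAlgebra.hom_ext (R := ℤ)
      (f := (ψ.comp (RingQuot.mkRingHom (LocRel α))).toIntAlgHom)
      (g := FreeAlgebra.lift ℤ β) (by
        funext z
        have h2 := hsuff z
        rw [← FreeAlgebra.lift_ι_apply (R := ℤ) β z] at h2
        exact h2)
    refine RingQuot.lift_unique _ hβ ψ ?_
    ext1 z
    exact DFunLike.congr_fun this z

end UniversalLocalization

end localization

/-!
Write `S` for the universal localization and `π : R → S` for the canonical map.  The rank function on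
`S` comes from a notion of rank for a finite family of elements of an arbitrary `S`-module `K`, i.e.
for a map `h : F → K` from a finitely generated projective `R`-module.  A finite set of `R`-linear
relations in `K` around `h` is a complex `A → B → K` with a lift `g : F → B` of `h`, and it bounds the
rank of `h` by `rk [g a] - rk a`, the rank of `F → coker a`; the rank of `h` is the infimum of these
bounds (`SylvesterMapRank.RankLE`).  The rank of an `S`-linear map `f : X → Y` is defined as the rank
in `Y` of the images of finitely many generators of `X` (`SylvesterMapRank.inducedRk`).  The axioms
are formal consequences of the following two facts about full maps, that is, maps whose rank is that
of the identity of their domain and of their codomain.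

* The rank of `h` only depends on the `S`-span of its image.  Indeed, if `α : P → Q` is full, then
  adjoining to a family the values of a map `k` on `Q`, where `k ∘ α` has values in the family, leaves
  the rank unchanged, because the new relations have rank `rk α = rk id_Q`
  (`RankLE.coprod_of_full`, `absorbsSMul_of_full`).
* For `f : F → M` over `R`, the rank of `F → M → S ⊗_R M` is `rk f`; it cannot be smaller
  (`rk_le_of_rankLE_unit`).  In particular `1` has rank one in `S`, so that `S` is nonzero.

For the second fact, ranks do not increase along `S`-linear maps, so that it suffices to find some
`S`-module under `M` in which ranks are those of `M`.  Adjoin to `M` a map `u ∘ β⁻¹` for every full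
map `β : V → W` and every `u : V → M`; by Sylvester's law of nullity this does not change ranks
(`RankLE.of_extension`).  Divide by the elements of rank zero, which does not change ranks either
(`RankLE.of_mkQ_null`).  In the resulting module, `FullLocalization`, maps extend along full maps:
uniquely, because the cokernel of a full map has rank zero, and they exist by Cramer's rule, because
block triangular maps with full diagonal blocks are full (`FullLocalization.exists_extend_sum`).
Hence `S` acts on it.
-/

/-! ### Consequences of the axioms of a Sylvester map rank function -/

namespace SylvesterMapRank

section basics

variable {R : Type u} [Ring R] (ρ : SylvesterMapRank R)
variable {P : Type u} [AddCommGroup P] [Module R P] [Module.Finite R P] [Module.Projective R P]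
variable {Q : Type u} [AddCommGroup Q] [Module R Q] [Module.Finite R Q] [Module.Projective R Q]
variable {N : Type u} [AddCommGroup N] [Module R N] [Module.Finite R N] [Module.Projective R N]
variable {L : Type u} [AddCommGroup L] [Module R L] [Module.Finite R L] [Module.Projective R L]

theorem rk_comp_le_left (f : P →ₗ[R] Q) (g : Q →ₗ[R] N) : ρ.rk (g ∘ₗ f) ≤ ρ.rk f :=
  (ρ.rk_comp_le f g).trans (min_le_left _ _)

theorem rk_comp_le_right (f : P →ₗ[R] Q) (g : Q →ₗ[R] N) : ρ.rk (g ∘ₗ f) ≤ ρ.rk g :=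
  (ρ.rk_comp_le f g).trans (min_le_right _ _)

theorem rk_le_of_eq_comp {f : P →ₗ[R] N} (g : P →ₗ[R] Q) (h : Q →ₗ[R] N)
    (H : ∀ x, f x = h (g x)) : ρ.rk f ≤ ρ.rk g := by
  rw [show f = h ∘ₗ g from LinearMap.ext H]
  exact ρ.rk_comp_le_left g h

theorem rk_le_of_eq_comp' {f : P →ₗ[R] N} (g : P →ₗ[R] Q) (h : Q →ₗ[R] N)
    (H : ∀ x, f x = h (g x)) : ρ.rk f ≤ ρ.rk h := by
  rw [show f = h ∘ₗ g from LinearMap.ext H]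
  exact ρ.rk_comp_le_right g h

theorem rk_le_id_right (f : P →ₗ[R] Q) : ρ.rk f ≤ ρ.rk (LinearMap.id : Q →ₗ[R] Q) :=
  ρ.rk_le_of_eq_comp' f LinearMap.id fun _ => rfl

theorem rk_le_id_left (f : P →ₗ[R] Q) : ρ.rk f ≤ ρ.rk (LinearMap.id : P →ₗ[R] P) :=
  ρ.rk_le_of_eq_comp LinearMap.id f fun _ => rfl

theorem rk_id_prod : ρ.rk (LinearMap.id : P × Q →ₗ[R] P × Q) =
    ρ.rk (LinearMap.id : P →ₗ[R] P) + ρ.rk (LinearMap.id : Q →ₗ[R] Q) := by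
  rw [← ρ.rk_diag, LinearMap.prodMap_id]

/-- The triangular axiom, for a map that is only known pointwise to be block triangular. -/
theorem rk_add_le_of_triangular {P' Q' : Type u}
    [AddCommGroup P'] [Module R P'] [Module.Finite R P'] [Module.Projective R P']
    [AddCommGroup Q'] [Module R Q'] [Module.Finite R Q'] [Module.Projective R Q']
    (f : P →ₗ[R] Q) (g : P' →ₗ[R] Q') (h : P →ₗ[R] Q') {t : P × P' →ₗ[R] Q × Q'}
    (ht : ∀ x y, t (x, y) = (f x, h x + g y)) : ρ.rk f + ρ.rk g ≤ ρ.rk t := by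
  refine (ρ.rk_triangular f g h).trans (le_of_eq ?_)
  congr 1
  refine LinearMap.ext fun ⟨x, y⟩ => ?_
  rw [ht]
  rfl

/-- Sylvester's law of nullity: the map `(y, x) ↦ (g y, y - f x)` has rank at least
`rk g + rk f`, and elementary row and column operations turn it into `(g ∘ f) ⊕ id`. -/
theorem rk_add_rk_le_rk_comp (f : P →ₗ[R] Q) (g : Q →ₗ[R] N) :
    ρ.rk f + ρ.rk g ≤ ρ.rk (g ∘ₗ f) + ρ.rk (LinearMap.id : Q →ₗ[R] Q) := by
  let t : Q × P →ₗ[R] N × Q :=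
    (g ∘ₗ LinearMap.fst R Q P).prod (LinearMap.fst R Q P - f ∘ₗ LinearMap.snd R Q P)
  have h1 : ρ.rk g + ρ.rk (-f) ≤ ρ.rk t :=
    ρ.rk_add_le_of_triangular g (-f) LinearMap.id fun x y => by simp [t, sub_eq_add_neg]
  have h2 : ρ.rk f ≤ ρ.rk (-f) :=
    ρ.rk_le_of_eq_comp (-f) (-LinearMap.id) fun x => by simp
  let s : P × Q →ₗ[R] N × Q := (g ∘ₗ f).prodMap LinearMap.id
  have h3 : ρ.rk t ≤ ρ.rk s := by
    let c : Q × P →ₗ[R] P × Q :=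
      (LinearMap.snd R Q P).prod (LinearMap.fst R Q P - f ∘ₗ LinearMap.snd R Q P)
    let d : N × Q →ₗ[R] N × Q :=
      (LinearMap.fst R N Q + g ∘ₗ LinearMap.snd R N Q).prod (LinearMap.snd R N Q)
    have : t = d ∘ₗ (s ∘ₗ c) := by
      refine LinearMap.ext fun ⟨x, y⟩ => ?_
      simp [t, d, s, c]
    rw [this]
    exact (ρ.rk_comp_le_left _ _).trans (ρ.rk_comp_le_right _ _)
  rw [← ρ.rk_diag (g ∘ₗ f) LinearMap.id]
  calc ρ.rk f + ρ.rk g ≤ ρ.rk g + ρ.rk (-f) := by rw [add_comm]; gcongr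
    _ ≤ _ := h1.trans h3

/-- If `β` has the rank of its domain, adjoining to a map `t` a component `e` such that `β ∘ e`
factors through `t` does not increase the rank. -/
theorem rk_prod_le (t : P →ₗ[R] Q) (e : P →ₗ[R] N) (β : N →ₗ[R] L) (γ : Q →ₗ[R] L)
    (hβ : ρ.rk β = ρ.rk (LinearMap.id : N →ₗ[R] N)) (h : ∀ x, β (e x) = γ (t x)) :
    ρ.rk (t.prod e) ≤ ρ.rk t := by
  have h1 := ρ.rk_add_rk_le_rk_comp (t.prod e) ((LinearMap.id : Q →ₗ[R] Q).prodMap β)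
  rw [ρ.rk_diag, hβ, ← rk_id_prod, add_le_add_iff_right] at h1
  refine h1.trans (ρ.rk_le_of_eq_comp t (LinearMap.id.prod γ) fun x => ?_)
  simp [h]

/-- A map between finitely generated projective modules is *full* if its rank is that of its domain
and that of its codomain. -/
def Full (f : P →ₗ[R] Q) : Prop :=
  ρ.rk f = ρ.rk (LinearMap.id : P →ₗ[R] P) ∧ ρ.rk f = ρ.rk (LinearMap.id : Q →ₗ[R] Q)

variable {ρ} in
theorem Full.triangular {P' Q' : Type u}
    [AddCommGroup P'] [Module R P'] [Module.Finite R P'] [Module.Projective R P']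
    [AddCommGroup Q'] [Module R Q'] [Module.Finite R Q'] [Module.Projective R Q']
    {f : P →ₗ[R] Q} {g : P' →ₗ[R] Q'} (hf : ρ.Full f) (hg : ρ.Full g) (h : P →ₗ[R] Q')
    {t : P × P' →ₗ[R] Q × Q'} (ht : ∀ x y, t (x, y) = (f x, h x + g y)) : ρ.Full t := by
  have key := ρ.rk_add_le_of_triangular f g h ht
  constructor
  · refine le_antisymm (ρ.rk_le_id_left _) ?_
    rwa [rk_id_prod, ← hf.1, ← hg.1]
  · refine le_antisymm (ρ.rk_le_id_right _) ?_
    rwa [rk_id_prod, ← hf.2, ← hg.2]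

end basics

end SylvesterMapRank

/-! ### The rank of a finite family of elements of a module -/

namespace SylvesterMapRank

section rankLE

variable {R : Type u} [Ring R] {ρ : SylvesterMapRank R} {S : Type*} [Ring S] {π : R →+* S}
variable {K : Type*} [AddCommGroup K] [Module S K]
variable {K' : Type*} [AddCommGroup K'] [Module S K']
variable {F : Type u} [AddCommGroup F] [Module R F] [Module.Finite R F] [Module.Projective R F]
variable {G : Type u} [AddCommGroup G] [Module R G] [Module.Finite R G] [Module.Projective R G]

/-- `ρ.RankLE h r` says that the image of `h : F → K` has rank at most `r` in `K`, as witnessed by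
finitely many `R`-linear relations in `K`: there are a complex `A → B → K` with `A` and `B` finitely
generated projective over `R`, and a lift `g : F → B` of `h`, such that the rank of `F → B / a(A)`,
that is `rk [g a] - rk a`, is at most `r`.

The target `K` is a module over a second ring `S`, regarded as an `R`-module along `π : R → S`; this
is expressed by `π`-semilinear maps. -/
inductive RankLE (ρ : SylvesterMapRank R) (h : F →ₛₗ[π] K) (r : ℝ≥0) : Prop
  | intro {A B : Type u} [AddCommGroup A] [Module R A] [Module.Finite R A] [Module.Projective R A]
      [AddCommGroup B] [Module R B] [Module.Finite R B] [Module.Projective R B]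
      (a : A →ₗ[R] B) (b : B →ₛₗ[π] K) (g : F →ₗ[R] B) (hba : ∀ x, b (a x) = 0)
      (hbg : ∀ x, b (g x) = h x) (hr : ρ.rk (g.coprod a) ≤ ρ.rk a + r) : RankLE ρ h r

theorem RankLE.of_factor {h : F →ₛₗ[π] K} (b : G →ₛₗ[π] K) (g : F →ₗ[R] G)
    (H : ∀ x, b (g x) = h x) : ρ.RankLE h (ρ.rk g) := by
  refine .intro (0 : G →ₗ[R] G) b g (by simp) H ?_
  rw [ρ.rk_zero, zero_add]
  exact ρ.rk_le_of_eq_comp' (LinearMap.fst R F G) g fun x => by simp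

theorem RankLE.zero : ρ.RankLE (0 : F →ₛₗ[π] K) 0 := by
  have := RankLE.of_factor (ρ := ρ) (h := (0 : F →ₛₗ[π] K)) 0 (0 : F →ₗ[R] F) (by simp)
  rwa [ρ.rk_zero] at this

theorem RankLE.mono {h : F →ₛₗ[π] K} {r s : ℝ≥0} (H : ρ.RankLE h r) (hrs : r ≤ s) :
    ρ.RankLE h s := by
  obtain ⟨a, b, g, hba, hbg, hr⟩ := H
  exact .intro a b g hba hbg (hr.trans (by gcongr))

theorem RankLE.map {h : F →ₛₗ[π] K} {r : ℝ≥0} (H : ρ.RankLE h r) (φ : K →ₗ[S] K')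
    {h' : F →ₛₗ[π] K'} (hh : ∀ x, h' x = φ (h x)) : ρ.RankLE h' r := by
  obtain ⟨a, b, g, hba, hbg, hr⟩ := H
  exact .intro a (φ.comp b) g (by simp [hba]) (by simp [hbg, hh]) hr

theorem RankLE.comp {h : F →ₛₗ[π] K} {r : ℝ≥0} (H : ρ.RankLE h r) (t : G →ₗ[R] F)
    {h' : G →ₛₗ[π] K} (hh : ∀ x, h' x = h (t x)) : ρ.RankLE h' r := by
  obtain ⟨a, b, g, hba, hbg, hr⟩ := H
  refine .intro a b (g ∘ₗ t) hba (by simp [hbg, hh]) (le_trans ?_ hr)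
  exact ρ.rk_le_of_eq_comp' (t.prodMap LinearMap.id) (g.coprod a) fun x => by simp

theorem RankLE.prod {h : F →ₛₗ[π] K} {h' : G →ₛₗ[π] K'} {r s : ℝ≥0} (H : ρ.RankLE h r)
    (H' : ρ.RankLE h' s) {t : F × G →ₛₗ[π] K × K'} (ht : ∀ x y, t (x, y) = (h x, h' y)) :
    ρ.RankLE t (r + s) := by
  obtain ⟨a, b, g, hba, hbg, hr⟩ := H
  obtain ⟨a', b', g', hba', hbg', hr'⟩ := H'
  refine .intro (a.prodMap a')
    { toFun := fun x => (b x.1, b' x.2)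
      map_add' := fun x y => by simp
      map_smul' := fun c x => by simp [map_smulₛₗ] } (g.prodMap g')
    (by simp [hba, hba']) (by rintro ⟨x, y⟩; simp [hbg, hbg', ht]) ?_
  rw [ρ.rk_diag, add_add_add_comm]
  refine le_trans ?_ (add_le_add hr hr')
  rw [← ρ.rk_diag]
  refine ρ.rk_le_of_eq_comp'
    (((LinearMap.fst R _ _).prodMap (LinearMap.fst R _ _)).prod
      ((LinearMap.snd R _ _).prodMap (LinearMap.snd R _ _))) _ fun x => ?_
  simp

theorem RankLE.add {h h' : F →ₛₗ[π] K} {r s : ℝ≥0} (H : ρ.RankLE h r) (H' : ρ.RankLE h' s) :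
    ρ.RankLE (h + h') (r + s) := by
  let t : F × F →ₛₗ[π] K × K :=
    { toFun := fun x => (h x.1, h' x.2)
      map_add' := fun x y => by simp
      map_smul' := fun c x => by simp [map_smulₛₗ] }
  let q : F × F →ₛₗ[π] K := (LinearMap.coprod LinearMap.id LinearMap.id).comp t
  have h1 : ρ.RankLE t (r + s) := H.prod H' fun _ _ => rfl
  have h2 : ρ.RankLE q (r + s) :=
    h1.map (LinearMap.coprod LinearMap.id LinearMap.id) fun _ => rfl
  exact h2.comp (LinearMap.id.prod LinearMap.id) fun x => by simp [q, t]

/-- Superadditivity for block triangular maps.  Given relations for `t`, the first block is bounded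
by adjoining the columns of the second one to the relations, the second block by the relations as
they are; the two bounds telescope. -/
theorem RankLE.triangular {h : F →ₛₗ[π] K} {h' : G →ₛₗ[π] K'} {c : F →ₛₗ[π] K'} {r : ℝ≥0}
    {t : F × G →ₛₗ[π] K × K'} (H : ρ.RankLE t r) (ht : ∀ x y, t (x, y) = (h x, c x + h' y)) :
    ∃ r₁ r₂, ρ.RankLE h r₁ ∧ ρ.RankLE h' r₂ ∧ r₁ + r₂ ≤ r := by
  obtain @⟨A, B, _, _, _, _, _, _, _, _, a, b, g, hba, hbg, hr⟩ := H
  let g₁ := g ∘ₗ LinearMap.inl R F G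
  let g₂ := g ∘ₗ LinearMap.inr R F G
  have e1 : ∀ x, b (g₁ x) = (h x, c x) := fun x => by
    simp only [g₁, LinearMap.comp_apply, LinearMap.inl_apply, hbg, ht, map_zero, add_zero]
  have e2 : ∀ x, b (g₂ x) = (0, h' x) := fun x => by
    simp only [g₂, LinearMap.comp_apply, LinearMap.inr_apply, hbg, ht, map_zero, zero_add]
  have l1 : ρ.rk a ≤ ρ.rk (g₂.coprod a) :=
    ρ.rk_le_of_eq_comp' (LinearMap.inr R G A) _ fun x => by simp
  have l2 : ρ.rk (g₂.coprod a) ≤ ρ.rk (g₁.coprod (g₂.coprod a)) :=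
    ρ.rk_le_of_eq_comp' (LinearMap.inr R F (G × A)) _ fun x => by simp
  have l3 : ρ.rk (g₁.coprod (g₂.coprod a)) ≤ ρ.rk (g.coprod a) :=
    ρ.rk_le_of_eq_comp' ((LinearMap.fst R F (G × A)).prod
      (LinearMap.fst R G A ∘ₗ LinearMap.snd R F (G × A)) |>.prod
      (LinearMap.snd R G A ∘ₗ LinearMap.snd R F (G × A))) _ fun x => by
        simp [g₁, g₂, ← map_add, ← add_assoc]
  refine ⟨ρ.rk (g₁.coprod (g₂.coprod a)) - ρ.rk (g₂.coprod a), ρ.rk (g₂.coprod a) - ρ.rk a,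
    .intro (g₂.coprod a) ((LinearMap.fst S K K').comp b) g₁ ?_ ?_ ?_,
    .intro a ((LinearMap.snd S K K').comp b) g₂ ?_ ?_ ?_, ?_⟩
  · rintro ⟨x, y⟩
    simp [e2, hba]
  · intro x
    simp [e1]
  · rw [add_tsub_cancel_of_le l2]
  · intro x
    simp [hba]
  · intro x
    simp [e2]
  · rw [add_tsub_cancel_of_le l1]
  · rw [tsub_add_tsub_cancel l2 l1, tsub_le_iff_left]
    exact l3.trans hr

/-- In a finitely generated projective `R`-module the rank of the image of `h` is not less than
`ρ.rk h`: no relations in a projective module can decrease it. -/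
theorem RankLE.rk_le {h : F →ₗ[R] G} {r : ℝ≥0} (H : ρ.RankLE h r) : ρ.rk h ≤ r := by
  obtain ⟨a, b, g, hba, hbg, hr⟩ := H
  have h1 : ρ.rk h + ρ.rk a ≤ ρ.rk ((b.prod LinearMap.id) ∘ₗ (g.coprod a)) :=
    ρ.rk_add_le_of_triangular h a g fun x y => by simp [hba, hbg]
  have h2 := (h1.trans (ρ.rk_comp_le_left _ _)).trans hr
  rwa [add_comm, add_le_add_iff_left] at h2

/-- A full map `α` kills nothing and reaches everything as far as rank is concerned: a map `k` on
the codomain of `α` such that `k ∘ α` factors through `h` adds nothing to the rank of `h`. -/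
theorem RankLE.coprod_of_full {P Q : Type u}
    [AddCommGroup P] [Module R P] [Module.Finite R P] [Module.Projective R P]
    [AddCommGroup Q] [Module R Q] [Module.Finite R Q] [Module.Projective R Q]
    {α : P →ₗ[R] Q} (hα : ρ.Full α) {h : F →ₛₗ[π] K} {r : ℝ≥0} (H : ρ.RankLE h r)
    (u : P →ₗ[R] F) (k : Q →ₛₗ[π] K) (hk : ∀ p, k (α p) = h (u p))
    {t : F × Q →ₛₗ[π] K} (ht : ∀ x y, t (x, y) = h x + k y) : ρ.RankLE t r := by
  obtain @⟨A, B, _, _, _, _, _, _, _, _, a, b, g, hba, hbg, hr⟩ := H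
  -- The relations for `h`, together with `h (u p) - k (α p) = 0`.
  let a' : P × A →ₗ[R] Q × B := (-(α ∘ₗ LinearMap.fst R P A)).prod ((g ∘ₗ u).coprod a)
  let b' : Q × B →ₛₗ[π] K :=
    { toFun := fun x => k x.1 + b x.2
      map_add' := fun x y => by simp only [Prod.fst_add, Prod.snd_add, map_add]; abel
      map_smul' := fun c x => by simp [map_smulₛₗ] }
  have e : ∀ x y, b' (x, y) = k x + b y := fun _ _ => rfl
  let g' : F × Q →ₗ[R] Q × B := (LinearMap.snd R F Q).prod (g ∘ₗ LinearMap.fst R F Q)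
  refine .intro a' b' g' ?_ ?_ ?_
  · rintro ⟨x, y⟩
    simp [a', e, hk, hbg, hba]
  · rintro ⟨x, y⟩
    simp [g', e, ht, hbg, add_comm]
  · have h1 : ρ.rk α + ρ.rk a ≤ ρ.rk a' := by
      refine (add_le_add_left (ρ.rk_le_of_eq_comp (-α) (-LinearMap.id) fun x => by simp)
        _).trans (ρ.rk_add_le_of_triangular (-α) a (g ∘ₗ u) fun x y => by simp [a'])
    have h2 : ρ.rk (g'.coprod a') ≤
        ρ.rk ((LinearMap.id : Q →ₗ[R] Q).prodMap (g.coprod a)) := by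
      let c : (F × Q) × (P × A) →ₗ[R] Q × (F × A) :=
        ((LinearMap.snd R F Q).coprod (-(α ∘ₗ LinearMap.fst R P A))).prod
        (((LinearMap.fst R F Q).coprod (u ∘ₗ LinearMap.fst R P A)).prod
          (LinearMap.snd R P A ∘ₗ LinearMap.snd R (F × Q) (P × A)))
      refine ρ.rk_le_of_eq_comp' c _ ?_
      rintro ⟨⟨x, y⟩, ⟨p, z⟩⟩
      simp [c, g', a', add_assoc]
    rw [ρ.rk_diag, ← hα.2] at h2
    calc ρ.rk (g'.coprod a') ≤ ρ.rk α + (ρ.rk a + r) := h2.trans (by gcongr)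
      _ = (ρ.rk α + ρ.rk a) + r := (add_assoc _ _ _).symm
      _ ≤ _ := by gcongr

end rankLE

end SylvesterMapRank

/-! ### The rank of a family in a module over the universal localization -/

namespace SylvesterMapRank

section absorb

variable {R : Type u} [Ring R] {ρ : SylvesterMapRank R} {S : Type*} [Ring S] {π : R →+* S}
variable {K : Type*} [AddCommGroup K] [Module S K]
variable {F : Type u} [AddCommGroup F] [Module R F]
variable {G : Type u} [AddCommGroup G] [Module R G]

theorem exists_factor_of_dual_basis {h : F →ₛₗ[π] K} {k : G →ₛₗ[π] K} {n : ℕ} {p : Fin n → G}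
    {f : Fin n → (G →ₗ[R] R)} (hp : ∀ x, x = ∑ j, f j x • p j)
    (H : ∀ j, k (p j) ∈ Set.range h) : ∃ t : G →ₗ[R] F, ∀ x, k x = h (t x) := by
  choose y hy using H
  refine ⟨∑ j, LinearMap.toSpanSingleton R F (y j) ∘ₗ f j, fun x => ?_⟩
  conv_lhs => rw [hp x]
  simp [map_sum, map_smulₛₗ, hy]

variable [Module.Finite R F] [Module.Projective R F] [Module.Finite R G] [Module.Projective R G]

variable (ρ) in
/-- `ρ.Absorbs h x` says that the family `h` can be enlarged to one that contains `x` without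
increasing its rank. -/
def Absorbs (h : F →ₛₗ[π] K) (x : K) : Prop :=
  ∃ (F' : Type u) (_ : AddCommGroup F') (_ : Module R F') (_ : Module.Finite R F')
    (_ : Module.Projective R F') (h' : F' →ₛₗ[π] K), Set.range h ⊆ Set.range h' ∧
      x ∈ Set.range h' ∧ ∀ r, ρ.RankLE h r → ρ.RankLE h' r

theorem Absorbs.of_mem {h : F →ₛₗ[π] K} {x : K} (hx : x ∈ Set.range h) : ρ.Absorbs h x :=
  ⟨F, _, _, ‹_›, ‹_›, h, subset_rfl, hx, fun _ => id⟩

variable (ρ π K) in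
/-- The scalars `s` for which the rank of a family does not change when `s • x` is adjoined, `x`
being a member of the family. -/
def AbsorbsSMul (s : S) : Prop :=
  ∀ {F : Type u} [AddCommGroup F] [Module R F] [Module.Finite R F] [Module.Projective R F]
    (h : F →ₛₗ[π] K), ∀ x ∈ Set.range h, ρ.Absorbs h (s • x)

theorem AbsorbsSMul.add {s t : S} (hs : ρ.AbsorbsSMul π K s) (ht : ρ.AbsorbsSMul π K t) :
    ρ.AbsorbsSMul π K (s + t) := by
  intro F _ _ _ _ h x hx
  obtain ⟨F₁, _, _, _, _, h₁, l₁, ⟨y, hy⟩, r₁⟩ := hs h x hx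
  obtain ⟨F₂, _, _, _, _, h₂, l₂, ⟨z, hz⟩, r₂⟩ := ht h₁ x (l₁ hx)
  obtain ⟨y', hy'⟩ := l₂ ⟨y, rfl⟩
  exact ⟨F₂, _, _, ‹_›, ‹_›, h₂, l₁.trans l₂, ⟨y' + z, by rw [map_add, hy', hy, hz, add_smul]⟩,
    fun r hr => r₂ r (r₁ r hr)⟩

theorem AbsorbsSMul.mul {s t : S} (hs : ρ.AbsorbsSMul π K s) (ht : ρ.AbsorbsSMul π K t) :
    ρ.AbsorbsSMul π K (s * t) := by
  intro F _ _ _ _ h x hx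
  obtain ⟨F₁, _, _, _, _, h₁, l₁, m₁, r₁⟩ := ht h x hx
  obtain ⟨F₂, _, _, _, _, h₂, l₂, m₂, r₂⟩ := hs h₁ _ m₁
  exact ⟨F₂, _, _, ‹_›, ‹_›, h₂, l₁.trans l₂, by rwa [mul_smul], fun r hr => r₂ r (r₁ r hr)⟩

theorem absorbs_of_mem_span (hS : ∀ s : S, ρ.AbsorbsSMul π K s) {T : Set K} {x : K}
    (hx : x ∈ Submodule.span S T) :
    ∀ {F : Type u} [AddCommGroup F] [Module R F] [Module.Finite R F] [Module.Projective R F]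
    (h : F →ₛₗ[π] K), T ⊆ Set.range h → ρ.Absorbs h x := by
  induction hx using Submodule.span_induction with
  | mem x hx => exact fun h hh => .of_mem (hh hx)
  | zero => exact fun h _ => .of_mem ⟨0, map_zero h⟩
  | add x y _ _ ihx ihy =>
    intro F _ _ _ _ h hh
    obtain ⟨F₁, _, _, _, _, h₁, l₁, ⟨y, hy⟩, r₁⟩ := ihx h hh
    obtain ⟨F₂, _, _, _, _, h₂, l₂, ⟨z, hz⟩, r₂⟩ := ihy h₁ (hh.trans l₁)
    obtain ⟨y', hy'⟩ := l₂ ⟨y, rfl⟩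
    exact ⟨F₂, _, _, ‹_›, ‹_›, h₂, l₁.trans l₂, ⟨y' + z, by rw [map_add, hy', hy, hz]⟩,
      fun r hr => r₂ r (r₁ r hr)⟩
  | smul s x _ ih =>
    intro F _ _ _ _ h hh
    obtain ⟨F₁, _, _, _, _, h₁, l₁, m₁, r₁⟩ := ih h hh
    obtain ⟨F₂, _, _, _, _, h₂, l₂, m₂, r₂⟩ := hS s h₁ _ m₁
    exact ⟨F₂, _, _, ‹_›, ‹_›, h₂, l₁.trans l₂, m₂, fun r hr => r₂ r (r₁ r hr)⟩

theorem RankLE.of_mem_span (hS : ∀ s : S, ρ.AbsorbsSMul π K s) {h : F →ₛₗ[π] K} {k : G →ₛₗ[π] K}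
    (hk : ∀ x, k x ∈ Submodule.span S (Set.range h)) {r : ℝ≥0} (H : ρ.RankLE h r) :
    ρ.RankLE k r := by
  obtain ⟨n, p, f, hp⟩ := UniversalLocalization.exists_dual_basis (R := R) G
  have key : ∀ s : Finset (Fin n), ∃ (F' : Type u) (_ : AddCommGroup F') (_ : Module R F')
      (_ : Module.Finite R F') (_ : Module.Projective R F') (h' : F' →ₛₗ[π] K),
      Set.range h ⊆ Set.range h' ∧ (∀ j ∈ s, k (p j) ∈ Set.range h') ∧ ρ.RankLE h' r := by
    intro s
    induction s using Finset.induction_on with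
    | empty => exact ⟨F, _, _, ‹_›, ‹_›, h, subset_rfl, by simp, H⟩
    | insert j s _ ih =>
      obtain ⟨F₁, _, _, _, _, h₁, l₁, m₁, r₁⟩ := ih
      obtain ⟨F₂, _, _, _, _, h₂, l₂, m₂, r₂⟩ := absorbs_of_mem_span hS (hk (p j)) h₁ l₁
      refine ⟨F₂, _, _, ‹_›, ‹_›, h₂, l₁.trans l₂, fun i hi => ?_, r₂ r r₁⟩
      obtain rfl | hi := Finset.mem_insert.1 hi
      exacts [m₂, l₂ (m₁ i hi)]
  obtain ⟨F', _, _, _, _, h', -, m, H'⟩ := key Finset.univ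
  obtain ⟨t, ht⟩ := exists_factor_of_dual_basis hp fun j => m j (Finset.mem_univ j)
  exact H'.comp t ht

end absorb

section localization

variable {R : Type u} [Ring R] {ι : Type w} {P Q : ι → Type u}
variable [∀ i, AddCommGroup (P i)] [∀ i, Module R (P i)]
variable [∀ i, Module.Finite R (P i)] [∀ i, Module.Projective R (P i)]
variable [∀ i, AddCommGroup (Q i)] [∀ i, Module R (Q i)]
variable [∀ i, Module.Finite R (Q i)] [∀ i, Module.Projective R (Q i)]
variable {α : ∀ i, P i →ₗ[R] Q i} {ρ : SylvesterMapRank R}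
variable {K : Type*} [AddCommGroup K] [Module (UniversalLocalization α) K]

open UniversalLocalization in
/-- If all the maps `α i` are full, then the rank of a family in a module over the universal
localization only depends on the submodule that it generates over the localization: the
localization is generated by `R` and by the coefficients of the inverses of the `α i`, and these are
absorbed by `RankLE.coprod_of_full`. -/
theorem absorbsSMul_of_full (hα : ∀ i, ρ.Full (α i)) (s : UniversalLocalization α) :
    ρ.AbsorbsSMul (of α) K s := by
  obtain ⟨z, rfl⟩ := RingQuot.mkRingHom_surjective (LocRel α) s
  induction z using FreeAlgebra.induction with
  | grade0 n =>
    rintro F _ _ _ _ h _ ⟨y, rfl⟩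
    refine .of_mem ⟨n • y, ?_⟩
    rw [map_zsmul]
    simpa using (Int.cast_smul_eq_zsmul (UniversalLocalization α) n (h y)).symm
  | grade1 z =>
    obtain r | ⟨i, q, f⟩ := z
    · rintro F _ _ _ _ h _ ⟨y, rfl⟩
      exact .of_mem ⟨r • y, map_smulₛₗ h r y⟩
    · rintro F _ _ _ _ h _ ⟨y, rfl⟩
      let k : Q i →ₛₗ[of α] K :=
        { toFun := fun q => b α i q f • h y
          map_add' := fun q q' => by rw [b_add_left, add_smul]
          map_smul' := fun r q => by rw [b_smul_left, mul_smul] }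
      let t : F × Q i →ₛₗ[of α] K :=
        { toFun := fun x => h x.1 + k x.2
          map_add' := fun x y => by simp only [Prod.fst_add, Prod.snd_add, map_add]; abel
          map_smul' := fun c x => by simp [map_smulₛₗ] }
      refine ⟨F × Q i, _, _, inferInstance, inferInstance, t, ?_, ⟨(0, q), ?_⟩, fun r hr => ?_⟩
      · rintro _ ⟨x, rfl⟩
        exact ⟨(x, 0), by simp [t]⟩
      · simp only [t, k, LinearMap.coe_mk, AddHom.coe_mk, map_zero, zero_add]
        rfl
      · refine hr.coprod_of_full (hα i) (LinearMap.toSpanSingleton R F y ∘ₗ f) k (fun p => ?_)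
          fun _ _ => rfl
        simp [k, b_inv_apply, map_smulₛₗ]
  | mul a b ha hb => rw [map_mul]; exact ha.mul hb
  | add a b ha hb => rw [map_add]; exact ha.add hb

end localization

end SylvesterMapRank

/-! ### Null elements -/

namespace SylvesterMapRank

section null

variable {R : Type u} [Ring R] (ρ : SylvesterMapRank R)
variable (E : Type*) [AddCommGroup E] [Module R E]

/-- The submodule of the elements of rank zero, the infimum over all relations being meant: `x` is
null if its rank is at most `ε` for every `ε > 0`. -/
def null : Submodule R E where
  carrier := {x | ∀ ε > 0, ρ.RankLE (LinearMap.toSpanSingleton R E x) ε}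
  add_mem' {x y} hx hy ε hε := by
    have h := (hx (ε / 2) (half_pos hε)).add (hy (ε / 2) (half_pos hε))
    rw [add_halves] at h
    exact h.comp LinearMap.id fun r => by simp
  zero_mem' ε _ := (RankLE.zero.mono (zero_le)).comp (h := (0 : R →ₗ[R] E)) LinearMap.id (by simp)
  smul_mem' r x hx ε hε := (hx ε hε).comp (LinearMap.toSpanSingleton R R r) fun s => by
    simp [mul_smul]

variable {ρ E}
variable {F : Type u} [AddCommGroup F] [Module R F] [Module.Finite R F] [Module.Projective R F]

theorem rankLE_of_mem_null {k : F →ₗ[R] E} (hk : ∀ x, k x ∈ ρ.null E) {ε : ℝ≥0} (hε : 0 < ε) :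
    ρ.RankLE k ε := by
  obtain ⟨n, p, f, hp⟩ := UniversalLocalization.exists_dual_basis (R := R) F
  have key : ∀ s : Finset (Fin n), ∀ ε : ℝ≥0, 0 < ε →
      ρ.RankLE (∑ j ∈ s, LinearMap.toSpanSingleton R E (k (p j)) ∘ₗ f j) ε := by
    intro s
    induction s using Finset.induction_on with
    | empty => exact fun ε _ => RankLE.zero.mono (zero_le)
    | insert j s hj ih =>
      intro ε hε
      rw [Finset.sum_insert hj, ← add_halves ε]
      refine .add ?_ (ih _ (half_pos hε))
      exact (hk (p j) _ (half_pos hε)).comp (f j) fun x => rfl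
  refine (key Finset.univ ε hε).comp LinearMap.id fun x => ?_
  conv_lhs => rw [hp x]
  simp [map_sum]

/-- Dividing out null elements does not change ranks. -/
theorem RankLE.of_mkQ_null {h : F →ₗ[R] E} {r : ℝ≥0}
    (H : ρ.RankLE ((ρ.null E).mkQ ∘ₗ h) r) {ε : ℝ≥0} (hε : 0 < ε) : ρ.RankLE h (r + ε) := by
  obtain @⟨A, B, _, _, _, _, _, _, _, _, a, b, g, hba, hbg, hr⟩ := H
  obtain ⟨c, hc⟩ := Module.projective_lifting_property (ρ.null E).mkQ b
    (ρ.null E).mkQ_surjective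
  replace hc : ∀ x, (ρ.null E).mkQ (c x) = b x := fun x => LinearMap.congr_fun hc x
  -- `k` collects the null elements by which `c` fails to be a family of relations for `h`.
  let k : F × A →ₗ[R] E := (c ∘ₗ g - h).coprod (c ∘ₗ a)
  have hk : ∀ x, k x ∈ ρ.null E := by
    rintro ⟨x, y⟩
    rw [← Submodule.Quotient.mk_eq_zero, ← Submodule.mkQ_apply]
    simp only [k, LinearMap.coprod_apply, map_add, LinearMap.sub_apply, map_sub,
      LinearMap.comp_apply, hc, hba, hbg]
    simp
  obtain @⟨A', B', _, _, _, _, _, _, _, _, a', b', g', hba', hbg', hr'⟩ := rankLE_of_mem_null hk hε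
  let a'' : A × A' →ₗ[R] B × B' :=
    (a ∘ₗ LinearMap.fst R A A').prod ((g' ∘ₗ LinearMap.inr R F A).coprod a')
  refine .intro a'' (c.coprod (-b')) (g.prod (g' ∘ₗ LinearMap.inl R F A)) ?_ ?_ ?_
  · rintro ⟨x, y⟩
    simp [a'', hba', hbg', k]
  · intro x
    simp [hbg', k]
  · have h1 : ρ.rk a + ρ.rk a' ≤ ρ.rk a'' :=
      ρ.rk_add_le_of_triangular a a' (g' ∘ₗ LinearMap.inr R F A) fun x y => by simp [a'']
    have h2 : ρ.rk ((g.prod (g' ∘ₗ LinearMap.inl R F A)).coprod a'') ≤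
        ρ.rk ((g.coprod a).prodMap (g'.coprod a')) := by
      let d : F × (A × A') →ₗ[R] (F × A) × ((F × A) × A') :=
        (LinearMap.id.prodMap (LinearMap.fst R A A')).prod
          ((LinearMap.id.prodMap (LinearMap.fst R A A')).prod
            (LinearMap.snd R A A' ∘ₗ LinearMap.snd R F (A × A')))
      refine ρ.rk_le_of_eq_comp' d _ ?_
      rintro ⟨x, y, z⟩
      have : g' (x, y) = g' (x, 0) + g' (0, y) := by simp [← map_add]
      simp [d, a'', this, add_assoc]
    rw [ρ.rk_diag] at h2
    calc _ ≤ _ := h2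
      _ ≤ (ρ.rk a + r) + (ρ.rk a' + ε) := add_le_add hr hr'
      _ = (ρ.rk a + ρ.rk a') + (r + ε) := add_add_add_comm _ _ _ _
      _ ≤ _ := by gcongr

theorem null_quotient_null {x : E ⧸ ρ.null E} (hx : x ∈ ρ.null (E ⧸ ρ.null E)) : x = 0 := by
  obtain ⟨y, rfl⟩ := (ρ.null E).mkQ_surjective x
  rw [Submodule.mkQ_apply, Submodule.Quotient.mk_eq_zero]
  intro ε hε
  have h : ρ.RankLE ((ρ.null E).mkQ ∘ₗ LinearMap.toSpanSingleton R E y) (ε / 2) :=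
    (hx _ (half_pos hε)).comp LinearMap.id fun r => by simp
  simpa using h.of_mkQ_null (half_pos hε)

/-- The cokernel of a full map has rank zero, so a map that kills the image of a full map has null
values. -/
theorem mem_null_of_comp_full_eq_zero {P Q : Type u}
    [AddCommGroup P] [Module R P] [Module.Finite R P] [Module.Projective R P]
    [AddCommGroup Q] [Module R Q] [Module.Finite R Q] [Module.Projective R Q]
    {α : P →ₗ[R] Q} (hα : ρ.Full α) {e : Q →ₗ[R] E} (he : ∀ p, e (α p) = 0) (q : Q) :
    e q ∈ ρ.null E := by
  intro ε _
  have h : ρ.RankLE e 0 := by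
    refine .intro α e LinearMap.id he (fun _ => rfl) ?_
    rw [add_zero, hα.2]
    exact ρ.rk_le_id_right _
  exact (h.mono (zero_le)).comp (LinearMap.toSpanSingleton R Q q) fun r => by simp

end null

end SylvesterMapRank

/-! ### A module on which all full maps act invertibly -/

namespace SylvesterMapRank

section roof

open scoped DirectSum

variable {R : Type u} [Ring R] (ρ : SylvesterMapRank R)
variable (M : Type u) [AddCommGroup M] [Module R M]

/-- A full map `β : V → W` together with a map `u : V → M`, standing for the map `u ∘ β⁻¹` from `W`
to the localization of `M`. -/
structure Roof where
  V : Type u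
  W : Type u
  [acgV : AddCommGroup V]
  [modV : Module R V]
  [finV : Module.Finite R V]
  [projV : Module.Projective R V]
  [acgW : AddCommGroup W]
  [modW : Module R W]
  [finW : Module.Finite R W]
  [projW : Module.Projective R W]
  β : V →ₗ[R] W
  full : ρ.Full β
  u : V →ₗ[R] M

attribute [instance] Roof.acgV Roof.modV Roof.finV Roof.projV
attribute [instance] Roof.acgW Roof.modW Roof.finW Roof.projW

open scoped Classical in
/-- The map whose cokernel is `ρ.Extension M`. -/
noncomputable def relMap : (⨁ k : Roof ρ M, k.V) →ₗ[R] M × ⨁ k : Roof ρ M, k.W :=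
  DirectSum.toModule R _ _ fun k =>
    k.u.prod (-(DirectSum.lof R (Roof ρ M) (fun k => k.W) k ∘ₗ k.β))

/-- The module obtained from `M` by adjoining for each roof `k` a map `k.W → ρ.Extension M` whose
composite with `k.β` is `k.u`.  It lives in `Type (u + 1)` since all roofs are used. -/
abbrev Extension : Type (u + 1) :=
  (M × ⨁ k : Roof ρ M, k.W) ⧸ LinearMap.range (relMap ρ M)

/-- The quotient of `ρ.Extension M` by its null elements: a module under `M` in which ranks are the
same as in `M` and to which maps extend uniquely along full maps. -/
abbrev FullLocalization : Type (u + 1) :=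
  Extension ρ M ⧸ ρ.null (Extension ρ M)

/-- The canonical map from `M` to its localization. -/
noncomputable def toLoc : M →ₗ[R] FullLocalization ρ M :=
  (ρ.null (Extension ρ M)).mkQ ∘ₗ (LinearMap.range (relMap ρ M)).mkQ ∘ₗ LinearMap.inl R _ _

open scoped Classical in
/-- The map `u ∘ β⁻¹` for a roof. -/
noncomputable def Roof.map {ρ : SylvesterMapRank R} {M : Type u} [AddCommGroup M] [Module R M]
    (k : Roof ρ M) : k.W →ₗ[R] FullLocalization ρ M :=
  (ρ.null (Extension ρ M)).mkQ ∘ₗ (LinearMap.range (relMap ρ M)).mkQ ∘ₗ LinearMap.inr R _ _ ∘ₗ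
    DirectSum.lof R (Roof ρ M) (fun k => k.W) k

variable {ρ M}

open scoped Classical in
theorem relMap_lof (k : Roof ρ M) (x : k.V) :
    relMap ρ M (DirectSum.lof R _ (fun k : Roof ρ M => k.V) k x) =
      (k.u x, -DirectSum.lof R _ (fun k : Roof ρ M => k.W) k (k.β x)) := by
  rw [relMap, DirectSum.toModule_lof]
  rfl

theorem component_snd_relMap (k : Roof ρ M) (z : ⨁ k : Roof ρ M, k.V) :
    DirectSum.component R _ (fun k : Roof ρ M => k.W) k (relMap ρ M z).2 =
      -k.β (DirectSum.component R _ (fun k : Roof ρ M => k.V) k z) := by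
  classical
  have : DirectSum.component R _ (fun k : Roof ρ M => k.W) k ∘ₗ LinearMap.snd R _ _ ∘ₗ relMap ρ M =
      -(k.β ∘ₗ DirectSum.component R _ (fun k : Roof ρ M => k.V) k) := by
    refine DirectSum.linearMap_ext R fun l => LinearMap.ext fun x => ?_
    simp only [LinearMap.comp_apply, LinearMap.neg_apply, relMap_lof, LinearMap.snd_apply, map_neg]
    by_cases hl : l = k
    · subst hl
      simp only [DirectSum.component.lof_self]
    · rw [DirectSum.component.of, DirectSum.component.of, dif_neg hl, dif_neg hl, map_zero, neg_zero]
  exact LinearMap.congr_fun this z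

theorem Roof.map_β (k : Roof ρ M) (x : k.V) : k.map (k.β x) = toLoc ρ M (k.u x) := by
  classical
  simp only [Roof.map, toLoc, LinearMap.comp_apply]
  congr 1
  rw [eq_comm, ← sub_eq_zero, ← map_sub, Submodule.mkQ_apply, Submodule.Quotient.mk_eq_zero]
  refine ⟨DirectSum.lof R _ (fun k : Roof ρ M => k.V) k x, ?_⟩
  rw [relMap_lof]
  ext1 <;> simp

/-- A map from a finitely generated module to a direct sum has finitely many components. -/
theorem exists_finset_eq_sum_lof {κ : Type*} [DecidableEq κ] {V : κ → Type*}
    [∀ k, AddCommGroup (V k)] [∀ k, Module R (V k)] {G : Type*} [AddCommGroup G] [Module R G]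
    [Module.Finite R G] (c : G →ₗ[R] ⨁ k, V k) :
    ∃ t : Finset κ, ∀ x, c x = ∑ k ∈ t, DirectSum.lof R κ V k (DirectSum.component R κ V k (c x)) := by
  classical
  obtain ⟨s, hs⟩ := (Module.Finite.fg_top : (⊤ : Submodule R G).FG)
  let t : Finset κ := s.biUnion fun x => DFinsupp.support (c x)
  refine ⟨t, fun x => ?_⟩
  have key : c = ∑ k ∈ t, DirectSum.lof R κ V k ∘ₗ DirectSum.component R κ V k ∘ₗ c := by
    refine LinearMap.ext_on hs fun y hy => ?_
    have h := DirectSum.sum_support_of (c y)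
    conv_lhs => rw [← h]
    rw [LinearMap.sum_apply]
    refine Finset.sum_subset (fun k hk => Finset.mem_biUnion.2 ⟨y, hy, hk⟩) fun k _ hk => ?_
    rw [DFinsupp.notMem_support_iff] at hk
    rw [hk, map_zero]
  conv_lhs => rw [key]
  simp

theorem exists_eq_toLoc_add_sum {G : Type u} [AddCommGroup G] [Module R G] [Module.Finite R G]
    [Module.Projective R G] (u : G →ₗ[R] FullLocalization ρ M) :
    ∃ (u₀ : G →ₗ[R] M) (t : Finset (Roof ρ M)) (w : ∀ k : Roof ρ M, G →ₗ[R] k.W),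
      ∀ x, u x = toLoc ρ M (u₀ x) + ∑ k ∈ t, k.map (w k x) := by
  classical
  obtain ⟨c, hc⟩ := Module.projective_lifting_property
    ((ρ.null (Extension ρ M)).mkQ ∘ₗ (LinearMap.range (relMap ρ M)).mkQ) u
    ((Submodule.mkQ_surjective _).comp (Submodule.mkQ_surjective _))
  obtain ⟨t, ht⟩ := exists_finset_eq_sum_lof (LinearMap.snd R _ _ ∘ₗ c)
  refine ⟨LinearMap.fst R _ _ ∘ₗ c, t, fun k => DirectSum.component R _ _ k ∘ₗ
    LinearMap.snd R _ _ ∘ₗ c, fun x => ?_⟩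
  rw [← hc]
  have h : c x = LinearMap.inl R _ _ (LinearMap.fst R _ _ (c x)) +
      LinearMap.inr R _ _ (LinearMap.snd R _ _ (c x)) := by ext1 <;> simp
  have h2 := ht x
  simp only [LinearMap.comp_apply] at h2 ⊢
  conv_lhs => rw [h, h2]
  simp only [map_add, map_sum]
  rfl

theorem FullLocalization.eq_zero_of_comp {P Q : Type u}
    [AddCommGroup P] [Module R P] [Module.Finite R P] [Module.Projective R P]
    [AddCommGroup Q] [Module R Q] [Module.Finite R Q] [Module.Projective R Q]
    {α : P →ₗ[R] Q} (hα : ρ.Full α) {e : Q →ₗ[R] FullLocalization ρ M}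
    (he : ∀ p, e (α p) = 0) (q : Q) : e q = 0 :=
  null_quotient_null (mem_null_of_comp_full_eq_zero hα he q)

/-- Cramer's rule: one round of adjoining solutions is enough, because the class of full maps is
closed under forming block triangular maps.  To extend along `α` a map `P → FullLocalization ρ M`
that involves the roof `k`, one extends along the triangular map with diagonal `α`, `k.β` instead,
which removes `k`. -/
theorem FullLocalization.exists_extend_sum (t : Finset (Roof ρ M)) :
    ∀ {P Q : Type u}
    [AddCommGroup P] [Module R P] [Module.Finite R P] [Module.Projective R P]
    [AddCommGroup Q] [Module R Q] [Module.Finite R Q] [Module.Projective R Q]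
    {α : P →ₗ[R] Q} (_ : ρ.Full α) (u : P →ₗ[R] M) (w : ∀ k : Roof ρ M, P →ₗ[R] k.W),
    ∃ e : Q →ₗ[R] FullLocalization ρ M, ∀ p, e (α p) =
      toLoc ρ M (u p) + ∑ k ∈ t, k.map (w k p) := by
  classical
  induction t using Finset.induction_on with
  | empty =>
    intro P Q _ _ _ _ _ _ _ _ α hα u w
    let k : Roof ρ M := { V := P, W := Q, β := α, full := hα, u := u }
    refine ⟨k.map, fun p => ?_⟩
    rw [Finset.sum_empty, add_zero]
    exact k.map_β p
  | insert k t hk ih =>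
    intro P Q _ _ _ _ _ _ _ _ α hα u w
    let α' : P × k.V →ₗ[R] Q × k.W :=
      (α ∘ₗ LinearMap.fst R P k.V).prod ((-w k).coprod k.β)
    have hα' : ρ.Full α' := hα.triangular k.full (-w k) fun x y => by simp [α']
    obtain ⟨e, he⟩ := ih hα' (u.coprod k.u) fun l => w l ∘ₗ LinearMap.fst R P k.V
    have h : ∀ q : k.W, e (0, q) = k.map q := by
      intro q
      rw [← sub_eq_zero]
      refine FullLocalization.eq_zero_of_comp k.full
        (e := e ∘ₗ LinearMap.inr R Q k.W - k.map) (fun p => ?_) q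
      have := he (0, p)
      have h2 : α' (0, p) = (0, k.β p) := by simp [α']
      rw [h2] at this
      simp [this, Roof.map_β]
    refine ⟨e ∘ₗ LinearMap.inl R Q k.W, fun p => ?_⟩
    have h1 := he (p, 0)
    have h2 : α' (p, 0) = (α p, 0) - (0, w k p) := by simp [α']
    rw [h2, map_sub, h, sub_eq_iff_eq_add] at h1
    rw [LinearMap.comp_apply, LinearMap.inl_apply, h1, Finset.sum_insert hk]
    simp only [LinearMap.coprod_apply, map_zero, add_zero, LinearMap.comp_apply,
      LinearMap.fst_apply]
    abel

theorem FullLocalization.exists_extend {P Q : Type u}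
    [AddCommGroup P] [Module R P] [Module.Finite R P] [Module.Projective R P]
    [AddCommGroup Q] [Module R Q] [Module.Finite R Q] [Module.Projective R Q]
    {α : P →ₗ[R] Q} (hα : ρ.Full α) (u : P →ₗ[R] FullLocalization ρ M) :
    ∃ e : Q →ₗ[R] FullLocalization ρ M, ∀ p, e (α p) = u p := by
  obtain ⟨u₀, t, w, hu⟩ := exists_eq_toLoc_add_sum u
  obtain ⟨e, he⟩ := FullLocalization.exists_extend_sum t hα u₀ w
  exact ⟨e, fun p => (he p).trans (hu p).symm⟩

variable {F : Type u} [AddCommGroup F] [Module R F] [Module.Finite R F] [Module.Projective R F]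

/-- Relations for `h` that use auxiliary elements coming from finitely many roofs: the auxiliary
elements can be adjoined to the relations one roof at a time. -/
theorem RankLE.of_finset_roof {A : Type u} [AddCommGroup A] [Module R A] [Module.Finite R A]
    [Module.Projective R A] {h : F →ₗ[R] M} {r : ℝ≥0} (c : ∀ k : Roof ρ M, F × A →ₗ[R] k.V)
    (s : Finset (Roof ρ M)) :
    ∀ {B : Type u} [AddCommGroup B] [Module R B] [Module.Finite R B] [Module.Projective R B]
    (t : F × A →ₗ[R] B) (b : B →ₗ[R] M) (γ : ∀ k : Roof ρ M, B →ₗ[R] k.W)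
    (_ : ∀ k x, k.β (c k x) = γ k (t x)) (_ : ∀ x, b (t x) = h x.1 + ∑ k ∈ s, k.u (c k x))
    (_ : ρ.rk t ≤ ρ.rk (t ∘ₗ LinearMap.inr R F A) + r), ρ.RankLE h r := by
  classical
  induction s using Finset.induction_on with
  | empty =>
    intro B _ _ _ _ t b γ _ hb hr
    refine .intro (t ∘ₗ LinearMap.inr R F A) b (t ∘ₗ LinearMap.inl R F A) ?_ ?_ ?_
    · intro x
      simp [hb]
    · intro x
      simp [hb]
    · refine (ρ.rk_le_of_eq_comp' LinearMap.id t fun x => ?_).trans hr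
      simp only [LinearMap.coprod_apply, LinearMap.comp_apply, ← map_add]
      simp
  | insert k s hk ih =>
    intro B _ _ _ _ t b γ hc hb hr
    refine ih (t.prod (c k)) (b.coprod (-k.u)) (fun l => γ l ∘ₗ LinearMap.fst R B k.V)
      (fun l x => by simp [hc]) (fun x => ?_) ?_
    · have h : (b.coprod (-k.u)) (t.prod (c k) x) = b (t x) - k.u (c k x) := by
        simp [sub_eq_add_neg]
      rw [h, hb, Finset.sum_insert hk]
      abel
    · refine (ρ.rk_prod_le t (c k) k.β (γ k) k.full.1 (hc k)).trans (hr.trans ?_)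
      gcongr
      exact ρ.rk_le_of_eq_comp _ (LinearMap.fst R B k.V) fun x => by simp

theorem RankLE.of_extension {h : F →ₗ[R] M} {r : ℝ≥0}
    (H : ρ.RankLE ((LinearMap.range (relMap ρ M)).mkQ ∘ₗ LinearMap.inl R _ _ ∘ₗ h) r) :
    ρ.RankLE h r := by
  classical
  obtain @⟨A, B, _, _, _, _, _, _, _, _, a, b, g, hba, hbg, hr⟩ := H
  obtain ⟨c, hc⟩ := Module.projective_lifting_property (LinearMap.range (relMap ρ M)).mkQ b
    (Submodule.mkQ_surjective _)
  replace hc : ∀ x, (LinearMap.range (relMap ρ M)).mkQ (c x) = b x :=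
    fun x => LinearMap.congr_fun hc x
  let t : F × A →ₗ[R] B := g.coprod a
  let d : F × A →ₗ[R] M × ⨁ k : Roof ρ M, k.W :=
    c ∘ₗ t - LinearMap.inl R _ _ ∘ₗ h ∘ₗ LinearMap.fst R F A
  have hd : ∀ x, d x ∈ LinearMap.range (relMap ρ M) := by
    rintro ⟨x, y⟩
    rw [← Submodule.Quotient.mk_eq_zero, ← Submodule.mkQ_apply]
    simp only [d, t, LinearMap.sub_apply, map_sub, LinearMap.comp_apply, hc,
      LinearMap.coprod_apply, map_add, hba, hbg, LinearMap.fst_apply]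
    simp
  obtain ⟨e, he⟩ := Module.projective_lifting_property (relMap ρ M).rangeRestrict
    (d.codRestrict _ hd) (relMap ρ M).surjective_rangeRestrict
  have hd' : ∀ x, relMap ρ M (e x) = c (t x) - (h x.1, 0) :=
    fun x => congrArg Subtype.val (LinearMap.congr_fun he x)
  obtain ⟨s, hs⟩ := exists_finset_eq_sum_lof e
  refine .of_finset_roof (fun k => DirectSum.component R _ _ k ∘ₗ e) s t (LinearMap.fst R _ _ ∘ₗ c)
    (fun k => -(DirectSum.component R _ _ k ∘ₗ LinearMap.snd R _ _ ∘ₗ c)) (fun k x => ?_)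
    (fun x => ?_) ?_
  · have h1 := component_snd_relMap k (e x)
    rw [hd', Prod.snd_sub, sub_zero] at h1
    rw [LinearMap.comp_apply, eq_comm]
    simp [h1]
  · have h1 : (relMap ρ M (e x)).1 =
        ∑ k ∈ s, k.u (DirectSum.component R _ _ k (e x)) := by
      conv_lhs => rw [hs x]
      simp only [map_sum, Prod.fst_sum, relMap_lof]
    rw [hd', Prod.fst_sub, sub_eq_iff_eq_add'] at h1
    exact h1
  · refine hr.trans (le_of_eq ?_)
    congr 2
    exact (LinearMap.coprod_inr g a).symm

/-- Ranks in the localization at all full maps are the same as in `M`. -/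
theorem RankLE.of_toLoc {h : F →ₗ[R] M} {r : ℝ≥0} (H : ρ.RankLE (toLoc ρ M ∘ₗ h) r) {ε : ℝ≥0}
    (hε : 0 < ε) : ρ.RankLE h (r + ε) :=
  RankLE.of_extension (RankLE.of_mkQ_null H hε)

end roof

end SylvesterMapRank

/-! ### The action of the universal localization -/

namespace UniversalLocalization

section action

variable {R : Type u} [Ring R] {ι : Type w} {P Q : ι → Type u}
variable [∀ i, AddCommGroup (P i)] [∀ i, Module R (P i)]
variable [∀ i, AddCommGroup (Q i)] [∀ i, Module R (Q i)]
variable {α : ∀ i, P i →ₗ[R] Q i}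
variable {N : Type*} [AddCommGroup N] [Module R N]

/-- Extension along `α i` of maps to a module `N` for which this is uniquely possible. -/
noncomputable def extend
    (hN : ∀ i, Function.Bijective fun e : Q i →ₗ[R] N => e ∘ₗ α i) (i : ι) :
    (P i →ₗ[R] N) ≃+ (Q i →ₗ[R] N) :=
  (AddEquiv.ofBijective
    (AddMonoidHom.mk' (fun e : Q i →ₗ[R] N => e ∘ₗ α i) fun _ _ => LinearMap.add_comp _ _ _)
    (hN i)).symm

theorem extend_comp (hN : ∀ i, Function.Bijective fun e : Q i →ₗ[R] N => e ∘ₗ α i) (i : ι)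
    (u : P i →ₗ[R] N) (p : P i) : extend hN i u (α i p) = u p :=
  LinearMap.congr_fun ((AddEquiv.ofBijective (AddMonoidHom.mk'
    (fun e : Q i →ₗ[R] N => e ∘ₗ α i) fun _ _ => LinearMap.add_comp _ _ _)
    (hN i)).apply_symm_apply u) p

theorem extend_eq (hN : ∀ i, Function.Bijective fun e : Q i →ₗ[R] N => e ∘ₗ α i) (i : ι)
    {u : P i →ₗ[R] N} {e : Q i →ₗ[R] N} (h : ∀ p, e (α i p) = u p) : extend hN i u = e :=
  (hN i).1 (LinearMap.ext fun p => by simp [extend_comp, h])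

/-- The endomorphism by which a generator of the universal localization acts on an `R`-module with
unique extensions along all `α i`: the symbol for `f (α i⁻¹ q)` sends `x` to the value at `q` of the
extension of `p ↦ f p • x`. -/
noncomputable def genAction (hN : ∀ i, Function.Bijective fun e : Q i →ₗ[R] N => e ∘ₗ α i) :
    LocGen R P Q → AddMonoid.End N
  | .coe r => Module.toAddMonoidEnd R N r
  | .inv i q f => AddMonoidHom.mk'
      (fun x => extend hN i (LinearMap.toSpanSingleton R N x ∘ₗ f) q) fun x y => by
        rw [← LinearMap.add_apply, ← map_add]
        congr 2
        ext p
        simp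

theorem genAction_coe (hN : ∀ i, Function.Bijective fun e : Q i →ₗ[R] N => e ∘ₗ α i) (r : R)
    (x : N) : genAction hN (.coe r) x = r • x :=
  rfl

theorem genAction_inv (hN : ∀ i, Function.Bijective fun e : Q i →ₗ[R] N => e ∘ₗ α i) (i : ι)
    (q : Q i) (f : P i →ₗ[R] R) (x : N) : genAction hN (.inv i q f) x =
      extend hN i (LinearMap.toSpanSingleton R N x ∘ₗ f) q :=
  rfl

/-- An `R`-module with unique extensions along all `α i` is a module over the universal
localization. -/
noncomputable def action (hN : ∀ i, Function.Bijective fun e : Q i →ₗ[R] N => e ∘ₗ α i) :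
    UniversalLocalization α →+* AddMonoid.End N :=
  RingQuot.lift ⟨(FreeAlgebra.lift ℤ (genAction hN) :
      FreeAlgebra ℤ (LocGen R P Q) →ₐ[ℤ] AddMonoid.End N), by
    intro x y h
    refine AddMonoidHom.ext fun z => ?_
    simp only [AlgHom.coe_toRingHom]
    induction h with
    | coe_one =>
      rw [FreeAlgebra.lift_ι_apply, map_one]
      exact one_smul R z
    | coe_add r s =>
      simp only [map_add, FreeAlgebra.lift_ι_apply]
      exact add_smul r s z
    | coe_mul r s =>
      simp only [map_mul, FreeAlgebra.lift_ι_apply]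
      exact mul_smul r s z
    | add_left i q q' f =>
      simp only [map_add, FreeAlgebra.lift_ι_apply]
      exact map_add (extend hN i _) q q'
    | add_right i q f f' =>
      simp only [map_add, FreeAlgebra.lift_ι_apply]
      refine (genAction_inv ..).trans ?_
      rw [LinearMap.comp_add, map_add]
      rfl
    | smul_left i r q f =>
      simp only [map_mul, FreeAlgebra.lift_ι_apply]
      exact map_smul (extend hN i _) r q
    | smul_right i r q f =>
      simp only [map_mul, FreeAlgebra.lift_ι_apply]
      change extend hN i (LinearMap.toSpanSingleton R N z ∘ₗ LinearMap.toSpanSingleton R R r ∘ₗ f) q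
        = extend hN i (LinearMap.toSpanSingleton R N (r • z) ∘ₗ f) q
      congr 2
      ext p
      simp [mul_smul]
    | inv_apply i p f =>
      simp only [FreeAlgebra.lift_ι_apply]
      exact extend_comp hN i _ p
    | apply_inv i q g =>
      simp only [FreeAlgebra.lift_ι_apply]
      exact LinearMap.congr_fun
        (extend_eq hN i (e := LinearMap.toSpanSingleton R N z ∘ₗ g) fun p => rfl) q⟩

theorem action_of (hN : ∀ i, Function.Bijective fun e : Q i →ₗ[R] N => e ∘ₗ α i) (r : R) (x : N) :
    action hN (of α r) x = r • x := by
  have : action hN (of α r) = genAction hN (.coe r) := by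
    refine (RingQuot.lift_mkRingHom_apply _ _ _).trans ?_
    simp
  rw [this, genAction_coe]

end action

end UniversalLocalization

namespace SylvesterMapRank

theorem RankLE.restrictScalars {R : Type u} [Ring R] {ρ : SylvesterMapRank R} {S : Type*} [Ring S]
    {π : R →+* S} {K : Type*} [AddCommGroup K] [Module S K] [Module R K]
    (hK : ∀ (r : R) (x : K), π r • x = r • x)
    {F : Type u} [AddCommGroup F] [Module R F] [Module.Finite R F] [Module.Projective R F]
    {h : F →ₛₗ[π] K} {r : ℝ≥0} (H : ρ.RankLE h r) {h' : F →ₗ[R] K} (hh : ∀ x, h' x = h x) :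
    ρ.RankLE h' r := by
  obtain ⟨a, b, g, hba, hbg, hr⟩ := H
  exact .intro a
    { toFun := b
      map_add' := map_add b
      map_smul' := fun r x => by rw [map_smulₛₗ, hK, RingHom.id_apply] } g hba
      (fun x => (hbg x).trans (hh x).symm) hr

section localization

variable {R : Type u} [Ring R] {ι : Type w} {P Q : ι → Type u}
variable [∀ i, AddCommGroup (P i)] [∀ i, Module R (P i)]
variable [∀ i, Module.Finite R (P i)] [∀ i, Module.Projective R (P i)]
variable [∀ i, AddCommGroup (Q i)] [∀ i, Module R (Q i)]
variable [∀ i, Module.Finite R (Q i)] [∀ i, Module.Projective R (Q i)]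
variable {α : ∀ i, P i →ₗ[R] Q i} {ρ : SylvesterMapRank R}

open UniversalLocalization in
/-- The relations that hold in `S ⊗_R M` do not decrease ranks, `S` being the localization at full
maps: by the universal property they hold in `FullLocalization ρ M`. -/
theorem rk_le_of_rankLE_unit (hα : ∀ i, ρ.Full (α i)) {F M : Type u}
    [AddCommGroup F] [Module R F] [Module.Finite R F] [Module.Projective R F]
    [AddCommGroup M] [Module R M] [Module.Finite R M] [Module.Projective R M]
    {f : F →ₗ[R] M} {r : ℝ≥0} (H : ρ.RankLE ((BaseChange.unit (of α) M).comp f) r) :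
    ρ.rk f ≤ r := by
  have hN : ∀ i, Function.Bijective fun e : Q i →ₗ[R] FullLocalization ρ M => e ∘ₗ α i := by
    refine fun i => ⟨fun e e' h => ?_, fun u => ?_⟩
    · refine LinearMap.ext fun q => sub_eq_zero.1 ?_
      refine FullLocalization.eq_zero_of_comp (hα i) (e := e - e') (fun p => ?_) q
      exact sub_eq_zero.2 (LinearMap.congr_fun h p)
    · obtain ⟨e, he⟩ := FullLocalization.exists_extend (hα i) u
      exact ⟨e, LinearMap.ext he⟩
  let _ : Module (UniversalLocalization α) (FullLocalization ρ M) :=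
    Module.compHom _ (action hN)
  have hof : ∀ (r : R) (x : FullLocalization ρ M), of α r • x = r • x := action_of hN
  let φ : M →ₛₗ[of α] FullLocalization ρ M :=
    { toFun := toLoc ρ M
      map_add' := map_add _
      map_smul' := fun r x => by rw [hof, map_smul] }
  have h1 : ρ.RankLE (φ.comp f) r := H.map (BaseChange.lift φ) fun x => by simp
  have h2 : ρ.RankLE (toLoc ρ M ∘ₗ f) r := h1.restrictScalars hof fun x => rfl
  exact le_of_forall_pos_le_add fun ε hε => (h2.of_toLoc hε).rk_le

end localization

end SylvesterMapRank

/-! ### The rank function on the universal localization -/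

namespace SylvesterMapRank

section induced

variable {R : Type u} [Ring R] {S : Type v} [Ring S] (π : R →+* S)

theorem exists_generating (X : Type*) [AddCommGroup X] [Module S X] [Module.Finite S X] :
    ∃ (n : ℕ) (h : (Fin n → R) →ₛₗ[π] X), Submodule.span S (Set.range h) = ⊤ := by
  obtain ⟨n, x, hx⟩ := Module.Finite.exists_fin (R := S) (M := X)
  refine ⟨n, { toFun := fun c => ∑ j, π (c j) • x j, map_add' := ?_, map_smul' := ?_ }, ?_⟩
  · intro c d
    simp [add_smul, Finset.sum_add_distrib]
  · intro r c
    simp [mul_smul, Finset.smul_sum]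
  · rw [eq_top_iff, ← hx, Submodule.span_le]
    rintro _ ⟨j, rfl⟩
    exact Submodule.subset_span ⟨Pi.single j 1, by simp [Pi.single_apply]⟩

variable {π} in
/-- The direct sum of two semilinear maps. -/
def semilinearProdMap {X X' : Type*} [AddCommGroup X] [Module S X] [AddCommGroup X'] [Module S X']
    {F F' : Type*} [AddCommGroup F] [Module R F] [AddCommGroup F'] [Module R F']
    (h : F →ₛₗ[π] X) (h' : F' →ₛₗ[π] X') : F × F' →ₛₗ[π] X × X' where
  toFun x := (h x.1, h' x.2)
  map_add' x y := by simp
  map_smul' c x := by simp [map_smulₛₗ]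

variable {π} in
theorem span_range_prod_eq_top {X X' : Type*} [AddCommGroup X] [Module S X] [AddCommGroup X']
    [Module S X'] {F F' : Type*} [AddCommGroup F] [Module R F] [AddCommGroup F'] [Module R F']
    {h : F →ₛₗ[π] X}
    (hh : Submodule.span S (Set.range h) = ⊤) {h' : F' →ₛₗ[π] X'}
    (hh' : Submodule.span S (Set.range h') = ⊤) {t : F × F' →ₛₗ[π] X × X'}
    (ht : ∀ x y, t (x, y) = (h x, h' y)) : Submodule.span S (Set.range t) = ⊤ := by
  have e1 : ∀ x, (x, (0 : X')) ∈ Submodule.span S (Set.range t) := by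
    intro x
    have hx : x ∈ Submodule.span S (Set.range h) := by rw [hh]; trivial
    have := Submodule.mem_map_of_mem (f := LinearMap.inl S X X') hx
    rw [Submodule.map_span] at this
    refine Submodule.span_mono ?_ this
    rintro _ ⟨_, ⟨z, rfl⟩, rfl⟩
    exact ⟨(z, 0), by simp [ht]⟩
  have e2 : ∀ y, ((0 : X), y) ∈ Submodule.span S (Set.range t) := by
    intro x
    have hx : x ∈ Submodule.span S (Set.range h') := by rw [hh']; trivial
    have := Submodule.mem_map_of_mem (f := LinearMap.inr S X X') hx
    rw [Submodule.map_span] at this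
    refine Submodule.span_mono ?_ this
    rintro _ ⟨_, ⟨z, rfl⟩, rfl⟩
    exact ⟨(0, z), by simp [ht]⟩
  rw [eq_top_iff]
  rintro ⟨x, y⟩ -
  simpa using add_mem (e1 x) (e2 y)

/-- The rank of an `S`-linear map `f` is that of the images under `f` of finitely many generators of
its domain. -/
noncomputable def inducedRk (ρ : SylvesterMapRank R) {X Y : Type*} [AddCommGroup X] [Module S X]
    [Module.Finite S X] [AddCommGroup Y] [Module S Y] (f : X →ₗ[S] Y) : ℝ≥0 :=
  sInf {r | ρ.RankLE (f.comp (exists_generating π X).choose_spec.choose) r}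

variable {π} {ρ : SylvesterMapRank R}
variable {F : Type u} [AddCommGroup F] [Module R F] [Module.Finite R F] [Module.Projective R F]

theorem rankLE_comp_of_generating {X Y : Type*} [AddCommGroup X] [Module S X]
    [AddCommGroup Y] [Module S Y] {f : X →ₗ[S] Y}
    (hS : ∀ s : S, ρ.AbsorbsSMul π Y s)
    {G : Type u} [AddCommGroup G] [Module R G] [Module.Finite R G] [Module.Projective R G]
    {h : F →ₛₗ[π] X} (hh : Submodule.span S (Set.range h) = ⊤) (k : G →ₛₗ[π] X) {r : ℝ≥0}
    (H : ρ.RankLE (f.comp h) r) : ρ.RankLE (f.comp k) r := by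
  refine H.of_mem_span hS fun x => ?_
  have h1 : f (k x) ∈ Submodule.map f (Submodule.span S (Set.range h)) := by
    rw [hh]
    exact ⟨k x, trivial, rfl⟩
  rw [Submodule.map_span, ← Set.range_comp] at h1
  exact h1

variable {X Y : Type*} [AddCommGroup X] [Module S X] [Module.Finite S X]
  [AddCommGroup Y] [Module S Y] {f : X →ₗ[S] Y}

theorem inducedRk_le (hS : ∀ s : S, ρ.AbsorbsSMul π Y s) {h : F →ₛₗ[π] X}
    (hh : Submodule.span S (Set.range h) = ⊤) {r : ℝ≥0} (H : ρ.RankLE (f.comp h) r) :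
    ρ.inducedRk π f ≤ r :=
  csInf_le' (rankLE_comp_of_generating hS hh _ H)

theorem le_inducedRk (hS : ∀ s : S, ρ.AbsorbsSMul π Y s) (h : F →ₛₗ[π] X) {s : ℝ≥0}
    (H : ∀ r, ρ.RankLE (f.comp h) r → s ≤ r) : s ≤ ρ.inducedRk π f :=
  le_csInf ⟨_, RankLE.of_factor (ρ := ρ) _ LinearMap.id fun _ => rfl⟩ fun r hr =>
    H r (rankLE_comp_of_generating hS (exists_generating π X).choose_spec.choose_spec h hr)

theorem rankLE_inducedRk_add (hS : ∀ s : S, ρ.AbsorbsSMul π Y s) (h : F →ₛₗ[π] X) {ε : ℝ≥0}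
    (hε : 0 < ε) : ρ.RankLE (f.comp h) (ρ.inducedRk π f + ε) := by
  obtain ⟨r, hr, hlt⟩ := exists_lt_of_csInf_lt
    ⟨_, RankLE.of_factor (ρ := ρ) _ LinearMap.id fun _ => rfl⟩
    (lt_add_of_pos_right (ρ.inducedRk π f) hε)
  exact rankLE_comp_of_generating hS (exists_generating π X).choose_spec.choose_spec h
    (RankLE.mono hr hlt.le)

theorem inducedRk_add_le_of_triangular {X' Y' : Type*} [AddCommGroup X'] [Module S X']
    [Module.Finite S X'] [AddCommGroup Y'] [Module S Y'] {g : X' →ₗ[S] Y'}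
    (hS : ∀ s : S, ρ.AbsorbsSMul π Y s) (hS' : ∀ s : S, ρ.AbsorbsSMul π Y' s)
    (hS'' : ∀ s : S, ρ.AbsorbsSMul π (Y × Y') s) (c : X →ₗ[S] Y') {t : X × X' →ₗ[S] Y × Y'}
    (ht : ∀ x y, t (x, y) = (f x, c x + g y)) :
    ρ.inducedRk π f + ρ.inducedRk π g ≤ ρ.inducedRk π t := by
  obtain ⟨n, h, hh⟩ := exists_generating π X
  obtain ⟨m, k, hk⟩ := exists_generating π X'
  refine le_inducedRk hS'' (semilinearProdMap h k) fun r hr => ?_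
  obtain ⟨r₁, r₂, h₁, h₂, hle⟩ := hr.triangular (h := f.comp h) (h' := g.comp k) (c := c.comp h)
    fun x y => ht (h x) (k y)
  exact (add_le_add (inducedRk_le hS hh h₁) (inducedRk_le hS' hk h₂)).trans hle

theorem inducedRk_prodMap_le {X' Y' : Type*} [AddCommGroup X'] [Module S X']
    [Module.Finite S X'] [AddCommGroup Y'] [Module S Y'] {g : X' →ₗ[S] Y'}
    (hS : ∀ s : S, ρ.AbsorbsSMul π Y s) (hS' : ∀ s : S, ρ.AbsorbsSMul π Y' s)
    (hS'' : ∀ s : S, ρ.AbsorbsSMul π (Y × Y') s) :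
    ρ.inducedRk π (f.prodMap g) ≤ ρ.inducedRk π f + ρ.inducedRk π g := by
  obtain ⟨n, h, hh⟩ := exists_generating π X
  obtain ⟨m, k, hk⟩ := exists_generating π X'
  refine le_of_forall_pos_le_add fun ε hε => ?_
  have H := (rankLE_inducedRk_add (f := f) hS h (half_pos hε)).prod
    (rankLE_inducedRk_add (f := g) hS' k (half_pos hε))
    (t := (f.prodMap g).comp (semilinearProdMap h k)) fun _ _ => rfl
  rw [add_add_add_comm, add_halves] at H
  exact inducedRk_le hS'' (span_range_prod_eq_top hh hk fun _ _ => rfl) H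

end induced

/-- The Sylvester map rank function induced along `π : R → S` by a rank function on `R`, provided
that the rank of a family in an `S`-module only depends on its `S`-span, and that `1` has rank at
least one in `S`. -/
noncomputable def induced {R : Type u} [Ring R] {S : Type v} [Ring S] (π : R →+* S)
    (ρ : SylvesterMapRank R)
    (hS : ∀ {K : Type v} [AddCommGroup K] [Module S K] (s : S), ρ.AbsorbsSMul π K s)
    (h1 : ∀ r, ρ.RankLE π.toSemilinearMap r → 1 ≤ r) : SylvesterMapRank S where
  rk f := ρ.inducedRk π f
  rk_zero {X Y} := by
    intros
    obtain ⟨n, h, hh⟩ := exists_generating π X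
    exact le_antisymm (inducedRk_le hS hh (RankLE.zero.comp LinearMap.id fun _ => rfl)) zero_le
  rk_id := by
    have hh : Submodule.span S (Set.range π.toSemilinearMap) = ⊤ := by
      rw [eq_top_iff]
      intro s _
      have h : (1 : S) ∈ Submodule.span S (Set.range π.toSemilinearMap) :=
        Submodule.subset_span ⟨1, map_one π⟩
      simpa using Submodule.smul_mem _ s h
    refine le_antisymm (inducedRk_le hS hh ?_) (le_inducedRk hS π.toSemilinearMap h1)
    rw [← ρ.rk_id]
    exact .of_factor π.toSemilinearMap LinearMap.id fun _ => rfl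
  rk_comp_le {X Y Z} := by
    intro _ _ _ _ _ _ _ _ _ _ _ _ f g
    obtain ⟨n, h, hh⟩ := exists_generating π X
    obtain ⟨m, k, hk⟩ := exists_generating π Y
    refine le_min ?_ ?_
    · refine le_inducedRk hS h fun r hr => inducedRk_le hS hh (hr.map g fun _ => rfl)
    · refine le_inducedRk hS k fun r hr => inducedRk_le hS hh ?_
      exact rankLE_comp_of_generating (f := g) hS hk (f.comp h) hr
  rk_diag {X Y X' Y'} := by
    intro _ _ _ _ _ _ _ _ _ _ _ _ _ _ _ _ f g
    exact le_antisymm (inducedRk_prodMap_le hS hS hS)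
      (inducedRk_add_le_of_triangular hS hS hS 0 fun x y => by simp)
  rk_triangular {X Y X' Y'} := by
    intro _ _ _ _ _ _ _ _ _ _ _ _ _ _ _ _ f g h
    exact inducedRk_add_le_of_triangular hS hS hS h fun x y => rfl

@[ext]
theorem ext {R : Type u} [Ring R] {ρ ρ' : SylvesterMapRank R}
    (h : ∀ {P Q : Type u} [AddCommGroup P] [Module R P] [Module.Finite R P] [Module.Projective R P]
      [AddCommGroup Q] [Module R Q] [Module.Finite R Q] [Module.Projective R Q] (f : P →ₗ[R] Q),
      ρ.rk f = ρ'.rk f) : ρ = ρ' := by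
  obtain ⟨rk, _, _, _, _, _⟩ := ρ
  obtain ⟨rk', _, _, _, _, _⟩ := ρ'
  have : @rk = @rk' := by
    funext P Q _ _ _ _ _ _ _ _ f
    exact h f
  subst this
  rfl

theorem nontrivial {R : Type u} [Ring R] (ρ : SylvesterMapRank R) : Nontrivial R := by
  by_contra hR
  have := not_nontrivial_iff_subsingleton.1 hR
  have h : (LinearMap.id : R →ₗ[R] R) = 0 := Subsingleton.elim _ _
  have h1 := ρ.rk_id
  rw [h, ρ.rk_zero] at h1
  exact zero_ne_one h1

end SylvesterMapRank

theorem theorem8p4 {R : Type u} [Ring R] {ι : Type w} (P Q : ι → Type u)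
    [∀ i, AddCommGroup (P i)] [∀ i, Module R (P i)]
    [∀ i, Module.Finite R (P i)] [∀ i, Module.Projective R (P i)]
    [∀ i, AddCommGroup (Q i)] [∀ i, Module R (Q i)]
    [∀ i, Module.Finite R (Q i)] [∀ i, Module.Projective R (Q i)]
    (α : ∀ i, P i →ₗ[R] Q i) (ρ : SylvesterMapRank R)
    (hρ : ∀ i, ρ.rk (α i) = ρ.rk (LinearMap.id : P i →ₗ[R] P i) ∧
      ρ.rk (α i) = ρ.rk (LinearMap.id : Q i →ₗ[R] Q i)) :
    Nontrivial (UniversalLocalization α) ∧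
      ρ ∈ Set.range (SylvesterMapRank.pullback.{u, w} (UniversalLocalization.of α)) := by
  have hα : ∀ i, ρ.Full (α i) := hρ
  let σ : SylvesterMapRank (UniversalLocalization α) :=
    ρ.induced (UniversalLocalization.of α) (SylvesterMapRank.absorbsSMul_of_full hα)
      fun r hr => by
        rw [← ρ.rk_id]
        refine SylvesterMapRank.rk_le_of_rankLE_unit hα (f := LinearMap.id) ?_
        exact hr.map (BaseChange.ringEquiv (UniversalLocalization.of α)).symm.toLinearMap fun x => by
          rw [LinearEquiv.coe_coe, LinearEquiv.eq_symm_apply]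
          simp [BaseChange.ringEquiv]
  refine ⟨σ.nontrivial, σ, SylvesterMapRank.ext fun {X Y} _ _ _ _ _ _ _ _ f => le_antisymm ?_ ?_⟩
  · refine SylvesterMapRank.inducedRk_le (SylvesterMapRank.absorbsSMul_of_full hα)
      (BaseChange.span_unit (UniversalLocalization.of α)) ?_
    exact .of_factor (BaseChange.unit (UniversalLocalization.of α) Y) f fun x => by simp
  · refine SylvesterMapRank.le_inducedRk (SylvesterMapRank.absorbsSMul_of_full hα)
      (BaseChange.unit (UniversalLocalization.of α) X) fun r hr => ?_
    exact SylvesterMapRank.rk_le_of_rankLE_unit hα (hr.comp LinearMap.id fun x => by simp)
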